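/- **Theorem 4.5.** For positive integers $n$ put $[n]=\{1,\dots,n\}$, and let $s\ge 0$. An $(s+1)$-partition of $[n]$ is a tuple $(P,w^1,\dots,w^s)$ where $P$ is a partition of $[n]$ and each $w^i$ assigns to every part of $P$ a subset of $[n]$ of the same cardinality (its $i$th label) such that the $i$th labels of the parts form a partition of $[n]$. Let $\Pi_{n,s+1}$ be the poset of all $(s+1)$-partitions of $[n]$ together with an additional least element $\hat 0$, where $(P,w^1,\dots,w^s)\le(P',w^{1\prime},\dots,w^{s\prime})$ if every part of $P'$ is a union of parts of $P$ and, for each $i$, its label in $w^{i\prime}$ is the union of the labels in $w^i$ of these parts. Its greatest element is $([n],\dots,[n])$. Identify the atom $(\{1\}\cdots\{n\},\{w^1_1\}\cdots\{w^1_n\},\dots,\{w^s_1\}\cdots\{w^s_n\})$ of $\Pi_{n,s+1}$ with the word $w^1_1\cdots w^1_n\cdots w^s_1\cdots w^s_n$, and order the atoms lexicographically. For $x\neq\hat 0$ let $A(x)$ be the lexicographically earliest atom that is $\le x$, and write $w^i_k(x)$ for the letter of $A(x)$ at position $n(i-1)+k$. Label the edges (cover relations) of $\Pi_{n,s+1}$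 by elements of $\mathbb Z^3$, ordered lexicographically, as follows. - If $x\neq\hat 0$ and $A(x)\ne A(y)$, then $\lambda(x\lessdot y)$ is the lexicographically first $(k,i,j)$ such that $w^i_k(x)\ne w^i_k(y)=j$. - If $x\neq\hat 0$ and $A(x)=A(y)$, then $\lambda(x\lessdot y)=(n,\max(I\cup J),0)$, where $I$ and $J$ are the two parts of the partition of $x$ that are merged in $y$. - If $a$ is the $m$th atom in the lexicographic order, then $\lambda(\hat 0\lessdot a)=(n-1,s+m,0)$. A maximal chain $\hat 0=C_0\lessdot C_1\lessdot\cdots\lessdot C_n$ of $\Pi_{n,s+1}$ is decreasing if its sequence of labels $\lambda(C_0\lessdot C_1),\dots,\lambda(C_{n-1}\lessdot C_n)$ is weakly decreasing. Let $\mathcal B_n^{s+1}$ be the set of decreasing maximal chains of $\Pi_{n,s+1}$ and, for $n\ge 2$, let $\mathcal B_n^{s+1,i}$ be the set of those whose highest edge has a label with middle coordinate $i$. Then $|\mathcal B_1^{s+1}|=1$ for all $s$, and for all $n\ge 2$, $s\ge 1$ and $1\le i\le s$, $$|\mathcal B_n^{s+1,i}|=\sum_{1\le\alpha\le n-1}\Big(\sum_{i\le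 i'\le s}|\mathcal B_\alpha^{s+1,i'}|\Big)\,|\mathcal B_{n-\alpha}^{s+1}|\binom{n-1}{\alpha-1}^{i}\binom{n-1}{\alpha}\binom{n}{\alpha}^{s-i},$$ where for $\alpha=1$ the inner sum over $i'$ is to be replaced by the single term $|\mathcal B_1^{s+1}|$. -/

import Mathlib

/-- An `(s+1)`-partition `(P, w¹, …, wˢ)` of `[n]`. The set `[n]` is `Fin n`, the element `k : Fin n`
standing for the integer `k + 1`. A block `b` is a part `b 0` of `P` together with its labels
`b 1, …, b s`. -/
@[ext]
structure VectorPartition (n s : ℕ) where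
  blocks : Finset (Fin (s + 1) → Finset (Fin n))
  nonempty : ∀ b ∈ blocks, (b 0).Nonempty
  card_eq : ∀ b ∈ blocks, ∀ h, (b h).card = (b 0).card
  /-- For each `h`, the sets `b h` partition `[n]`. -/
  partition : ∀ h : Fin (s + 1), ∀ x : Fin n, ∃! b, b ∈ blocks ∧ x ∈ b h

namespace VectorPartition

variable {n s : ℕ}

theorem blocks_eq (X : VectorPartition n s) {b c : Fin (s + 1) → Finset (Fin n)}
    (hb : b ∈ X.blocks) (hc : c ∈ X.blocks) {h : Fin (s + 1)} {x : Fin n}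
    (hxb : x ∈ b h) (hxc : x ∈ c h) : b = c :=
  (X.partition h x).unique ⟨hb, hxb⟩ ⟨hc, hxc⟩

/-- `X ≤ Y` if every part of `Y` is a union of parts of `X`, and its labels are the unions of the
corresponding labels. -/
instance : LE (VectorPartition n s) where
  le X Y := ∀ c ∈ Y.blocks, ∃ S ⊆ X.blocks, ∀ h, c h = S.biUnion (fun b => b h)

theorem le_iff (X Y : VectorPartition n s) :
    X ≤ Y ↔ ∀ b ∈ X.blocks, ∃ c ∈ Y.blocks, ∀ h, b h ⊆ c h := by
  classical
  constructor
  · intro H b hb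
    obtain ⟨x, hx⟩ := X.nonempty b hb
    obtain ⟨c, ⟨hc, hxc⟩, -⟩ := Y.partition 0 x
    obtain ⟨S, hS, hcS⟩ := H c hc
    refine ⟨c, hc, fun h => ?_⟩
    rw [hcS 0, Finset.mem_biUnion] at hxc
    obtain ⟨b', hb', hxb'⟩ := hxc
    obtain rfl := X.blocks_eq hb (hS hb') hx hxb'
    rw [hcS h]
    exact Finset.subset_biUnion_of_mem (fun b => b h) hb'
  · intro H c hc
    refine ⟨X.blocks.filter (fun b => ∀ h, b h ⊆ c h), Finset.filter_subset _ _, fun h => ?_⟩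
    ext x
    simp only [Finset.mem_biUnion, Finset.mem_filter]
    constructor
    · intro hx
      obtain ⟨b, ⟨hb, hxb⟩, -⟩ := X.partition h x
      obtain ⟨c', hc', hbc⟩ := H b hb
      obtain rfl := Y.blocks_eq hc hc' hx (hbc h hxb)
      exact ⟨b, ⟨hb, hbc⟩, hxb⟩
    · rintro ⟨b, ⟨-, hbc⟩, hxb⟩
      exact hbc h hxb

theorem blocks_subset_of_le {X Y : VectorPartition n s} (hXY : X ≤ Y) (hYX : Y ≤ X) :
    X.blocks ⊆ Y.blocks := by
  intro b hb
  obtain ⟨c, hc, hbc⟩ := (le_iff X Y).1 hXY b hb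
  obtain ⟨b', hb', hcb⟩ := (le_iff Y X).1 hYX c hc
  obtain ⟨x, hx⟩ := X.nonempty b hb
  obtain rfl := X.blocks_eq hb hb' hx (hcb 0 (hbc 0 hx))
  have : b = c := funext fun h => Finset.Subset.antisymm (hbc h) (hcb h)
  exact this ▸ hc

instance : PartialOrder (VectorPartition n s) where
  le_refl X := (le_iff X X).2 fun b hb => ⟨b, hb, fun _ => Finset.Subset.refl _⟩
  le_trans X Y Z hXY hYZ := (le_iff X Z).2 fun b hb => by
    obtain ⟨c, hc, hbc⟩ := (le_iff X Y).1 hXY b hb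
    obtain ⟨d, hd, hcd⟩ := (le_iff Y Z).1 hYZ c hc
    exact ⟨d, hd, fun h => (hbc h).trans (hcd h)⟩
  le_antisymm X Y hXY hYX := VectorPartition.ext <|
    Finset.Subset.antisymm (blocks_subset_of_le hXY hYX) (blocks_subset_of_le hYX hXY)

instance : Finite (VectorPartition n s) :=
  Finite.of_injective VectorPartition.blocks fun _ _ h => VectorPartition.ext h

end VectorPartition

/-- The bounded poset `Π_{n,s+1}`: the `(s+1)`-partitions of `[n]` with a least element `⊥`
added. -/
abbrev VectorPartitionPoset (n s : ℕ) : Type := WithBot (VectorPartition n s)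

/-- Words `w¹₁ … w¹ₙ …… wˢ₁ … wˢₙ` with letters in `[n]`, in lexicographic order. The letter `wⁱₖ` is
at position `(i, k)`, and positions are read with `i` first. -/
abbrev AtomWord (n s : ℕ) : Type := Lex (Fin s ×ₗ Fin n → Fin n)

/-- The letter `wⁱₖ` of a word. -/
def AtomWord.letter {n s : ℕ} (w : AtomWord n s) (i : Fin s) (k : Fin n) : Fin n :=
  ofLex w (toLex (i, k))

namespace VectorPartition

variable {n s : ℕ}

/-- `a` is the atom `({1}{2}…{n}, {w¹₁}…{w¹ₙ}, …, {wˢ₁}…{wˢₙ})` that is identified with the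
word `w`. -/
def IsAtomWithWord (a : VectorPartition n s) (w : AtomWord n s) : Prop :=
  a.blocks = Finset.univ.image
    (fun k : Fin n => (Fin.cons {k} (fun i => {w.letter i k}) : Fin (s + 1) → Finset (Fin n)))

open Classical in
/-- The words of the atoms that lie below `X`. -/
noncomputable def atomWordsBelow (X : VectorPartition n s) : Finset (AtomWord n s) :=
  Finset.univ.filter fun w => ∃ a : VectorPartition n s, a.IsAtomWithWord w ∧ a ≤ X

theorem exists_mapsTo_injOn {t u : Finset (Fin n)} (h : u.card = t.card) :
    ∃ f : Fin n → Fin n, (∀ x ∈ t, f x ∈ u) ∧ ∀ x ∈ t, ∀ y ∈ t, f x = f y → x = y := by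
  classical
  let e := Finset.equivOfCardEq h.symm
  refine ⟨fun x => if hx : x ∈ t then (e ⟨x, hx⟩ : Fin n) else x, fun x hx => ?_,
    fun x hx y hy hxy => ?_⟩
  · simp only [hx, dite_true]
    exact (e ⟨x, hx⟩).2
  · simp only [hx, hy, dite_true] at hxy
    exact congrArg Subtype.val (e.injective (Subtype.ext hxy))

theorem atomWordsBelow_nonempty (X : VectorPartition n s) : X.atomWordsBelow.Nonempty := by
  classical
  choose B hB using fun (h : Fin (s + 1)) (x : Fin n) => (X.partition h x).exists
  have key : ∃ F : (Fin (s + 1) → Finset (Fin n)) → Fin (s + 1) → Fin n → Fin n,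
      ∀ b ∈ X.blocks, ∀ h, (∀ x ∈ b 0, F b h x ∈ b h) ∧
        ∀ x ∈ b 0, ∀ y ∈ b 0, F b h x = F b h y → x = y := by
    have : ∀ (b : Fin (s + 1) → Finset (Fin n)) (h : Fin (s + 1)), ∃ f : Fin n → Fin n,
        b ∈ X.blocks → (∀ x ∈ b 0, f x ∈ b h) ∧ ∀ x ∈ b 0, ∀ y ∈ b 0, f x = f y → x = y := by
      intro b h
      by_cases hb : b ∈ X.blocks
      · obtain ⟨f, hf⟩ := exists_mapsTo_injOn (X.card_eq b hb h)
        exact ⟨f, fun _ => hf⟩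
      · exact ⟨id, fun hb' => absurd hb' hb⟩
    choose F hF using this
    exact ⟨F, fun b hb h => hF b h hb⟩
  obtain ⟨F, hF⟩ := key
  let v : Fin s → Fin n → Fin n := fun i k => F (B 0 k) i.succ k
  have hv : ∀ i k, v i k ∈ B 0 k i.succ := fun i k =>
    (hF _ (hB 0 k).1 i.succ).1 k (hB 0 k).2
  have hinj : ∀ i, Function.Injective (v i) := by
    intro i k k' hkk
    have hbb : B 0 k = B 0 k' :=
      X.blocks_eq (hB 0 k).1 (hB 0 k').1 (hv i k) (hkk ▸ hv i k')
    refine (hF _ (hB 0 k).1 i.succ).2 k (hB 0 k).2 k' (hbb ▸ (hB 0 k').2) ?_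
    have : v i k = v i k' := hkk
    simp only [v] at this
    rw [this, hbb]
  let w : AtomWord n s := toLex fun p => v (ofLex p).1 (ofLex p).2
  let blk : Fin n → Fin (s + 1) → Finset (Fin n) := fun k =>
    Fin.cons {k} (fun i => {w.letter i k})
  have hblk : ∀ k i, blk k (Fin.succ i) = {v i k} := fun k i => rfl
  let a : VectorPartition n s :=
    { blocks := Finset.univ.image blk
      nonempty := by
        intro b hb
        obtain ⟨k, -, rfl⟩ := Finset.mem_image.1 hb
        exact ⟨k, Finset.mem_singleton_self k⟩
      card_eq := by
        intro b hb h
        obtain ⟨k, -, rfl⟩ := Finset.mem_image.1 hb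
        refine Fin.cases rfl (fun i => ?_) h
        rw [hblk, Finset.card_singleton]
        rfl
      partition := by
        intro h x
        refine Fin.cases ?_ (fun i => ?_) h
        · refine ⟨blk x, ⟨Finset.mem_image_of_mem _ (Finset.mem_univ _),
            Finset.mem_singleton_self x⟩, ?_⟩
          rintro b ⟨hb, hx⟩
          obtain ⟨k, -, rfl⟩ := Finset.mem_image.1 hb
          rw [Finset.mem_singleton.1 (show x ∈ ({k} : Finset (Fin n)) from hx)]
        · obtain ⟨k, rfl⟩ := (Finite.injective_iff_surjective.1 (hinj i)) x
          refine ⟨blk k, ⟨Finset.mem_image_of_mem _ (Finset.mem_univ _), ?_⟩, ?_⟩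
          · rw [hblk]
            exact Finset.mem_singleton_self _
          · rintro b ⟨hb, hx⟩
            obtain ⟨k', -, rfl⟩ := Finset.mem_image.1 hb
            rw [hblk, Finset.mem_singleton] at hx
            rw [hinj i hx] }
  refine ⟨w, Finset.mem_filter.2 ⟨Finset.mem_univ _, a, rfl, (le_iff a X).2 ?_⟩⟩
  intro b hb
  obtain ⟨k, -, rfl⟩ := Finset.mem_image.1 hb
  refine ⟨B 0 k, (hB 0 k).1, fun h => ?_⟩
  refine Fin.cases ?_ (fun i => ?_) h
  · exact Finset.singleton_subset_iff.2 (hB 0 k).2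
  · rw [hblk]
    exact Finset.singleton_subset_iff.2 (hv i k)

/-- The (word of the) atom `A(X)` of `X`: the lexicographically earliest atom below `X`. -/
noncomputable def atomWord (X : VectorPartition n s) : AtomWord n s :=
  X.atomWordsBelow.min' X.atomWordsBelow_nonempty

end VectorPartition

/-- The label set `ℤ × ℤ × ℤ`, ordered lexicographically. -/
abbrev EdgeLabel : Type := ℤ ×ₗ ℤ ×ₗ ℤ

/-- The label `(k, i, j)`. -/
def EdgeLabel.mk (k i j : ℤ) : EdgeLabel := toLex (k, toLex (i, j))

/-- The middle coordinate `i` of the label `(k, i, j)`. -/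
def EdgeLabel.middle (l : EdgeLabel) : ℤ := (ofLex (ofLex l).2).1

/-- All `(k, i, j)` with `wⁱₖ ≠ w'ⁱₖ` and `w'ⁱₖ = j`, where elements of `[n]` and `[s]` are written as
integers starting from `1`. -/
def AtomWord.differences {n s : ℕ} (w w' : AtomWord n s) : Finset EdgeLabel :=
  (Finset.univ.filter fun p : Fin n × Fin s => w.letter p.2 p.1 ≠ w'.letter p.2 p.1).image
    fun p => EdgeLabel.mk ((p.1 : ℤ) + 1) ((p.2 : ℤ) + 1) ((w'.letter p.2 p.1 : ℤ) + 1)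

theorem AtomWord.differences_nonempty {n s : ℕ} {w w' : AtomWord n s} (h : w ≠ w') :
    (w.differences w').Nonempty := by
  have : ∃ p, ofLex w p ≠ ofLex w' p := by
    by_contra hc
    push Not at hc
    exact h (congrArg toLex (funext hc))
  obtain ⟨p, hp⟩ := this
  exact Finset.Nonempty.image
    ⟨((ofLex p).2, (ofLex p).1), Finset.mem_filter.2 ⟨Finset.mem_univ _, hp⟩⟩ _

namespace VectorPartition

variable {n s : ℕ}

/-- The largest integer in `I ∪ J`, where `Y` is obtained from `X` by merging the parts `I` and `J`
of `X`: these are the parts of the blocks of `X` that are not blocks of `Y`. -/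
def mergedMax (X Y : VectorPartition n s) : ℕ :=
  (X.blocks \ Y.blocks).sup fun b => (b 0).sup fun k => (k : ℕ) + 1

/-- The position `m ≥ 1` of the atom `a` in the lexicographic order on the atoms
of `Π_{n,s+1}`. -/
noncomputable def atomRank (a : VectorPartition n s) : ℕ :=
  {a' : VectorPartition n s |
    IsAtom (a' : VectorPartitionPoset n s) ∧ a'.atomWord ≤ a.atomWord}.ncard

end VectorPartition

/-- The edge labeling `λ(x ⋖ y)` of `Π_{n,s+1}`. It is meaningful if `x ⋖ y`, and the last case never
occurs then. -/
noncomputable def edgeLabel {n s : ℕ} :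
    VectorPartitionPoset n s → VectorPartitionPoset n s → EdgeLabel
  | some X, some Y =>
      if h : X.atomWord ≠ Y.atomWord then
        (X.atomWord.differences Y.atomWord).min' (AtomWord.differences_nonempty h)
      else EdgeLabel.mk n (X.mergedMax Y) 0
  | none, some a => EdgeLabel.mk ((n : ℤ) - 1) ((s : ℤ) + a.atomRank) 0
  | _, none => EdgeLabel.mk 0 0 0

/-- The set `B_n^{s+1}` of decreasing maximal chains of `Π_{n,s+1}`: the labels weakly decrease along
the chain. Mathlib's `Flag` is a chain that is maximal with respect to inclusion. -/
def decreasingChains (n s : ℕ) : Set (Flag (VectorPartitionPoset n s)) :=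
  {C | ∀ x ∈ C, ∀ y ∈ C, ∀ z ∈ C, x ⋖ y → y ⋖ z → edgeLabel y z ≤ edgeLabel x y}

/-- The set `B_n^{s+1,i}` of decreasing maximal chains of `Π_{n,s+1}` whose highest edge has a label
with middle coordinate `i`. -/
def decreasingChainsWithTop (n s i : ℕ) : Set (Flag (VectorPartitionPoset n s)) :=
  {C | C ∈ decreasingChains n s ∧ ∃ x ∈ C, ∃ y ∈ C, x ⋖ y ∧ (∀ z ∈ C, z ≤ y) ∧
    (edgeLabel x y).middle = i}

/-! The count is carried out below every `X`, with a bound `L` on the labels. Labels decrease going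
up, so bounding the highest one bounds all of them. The heart is `chainCount_eq_prod`: for `L` at
most `(n - 1, s + 1, 0)`, the number of decreasing chains below `X` with labels at least `L` is the
product of `weight b L` over the blocks `b` of `X`. The theorem is the case of a single block.

A lower cover of `X` other than `⊥` splits a block `b` into `I`, which contains the least element of
the part, and `b \ I`. The first atom pairs each part increasingly with each of its labels, so
minimum goes with minimum. If some label of `I` misses the minimum of the corresponding label of
`b`, the first such index `i` gives the edge label `minLabel b i`. If none does, no decreasing chain
continues below the edge: either the first atom is unchanged and the first coordinate `n` is too
large for any bottom edge, or the edge label exceeds every `minLabel I j` while `I` is not a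
singleton, so the weight of `I` vanishes.

For a given `i`, the weight of `I` allows exactly the indices from `i` on, the weight of `b \ I`
allows all indices, and the splittings with `I` of size `α` are counted by the binomials of the
recursion. So they sum to `topCount` (`sum_weight_mul_weight`). As the labels `minLabel b i` are
distinct, `prod_add_sum_filter_eq` reassembles these contributions into the product. -/

/-! ### Expanding a product by its least label -/

/-- Expanding the left side picks, for each `b`, either `c b` or some `τ p`. Unless only `c b` are
picked, let `q` be the pick of least label; every other pick `p` then satisfies `ℓ q ≤ ℓ p`.
Injectivity of `ℓ` makes `q` unique. -/
theorem prod_add_sum_filter_eq {ι κ L R : Type*} [LinearOrder L] [CommSemiring R] [DecidableEq ι]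
    [DecidableEq κ] (B : Finset ι) (c : ι → R) (τ : ι × κ → R) (ℓ : ι × κ → L)
    (S : Finset (ι × κ)) (hS : ∀ p ∈ S, p.1 ∈ B) (hℓ : Set.InjOn ℓ S) :
    ∏ b ∈ B, (c b + ∑ p ∈ S with p.1 = b, τ p) =
      ∏ b ∈ B, c b + ∑ q ∈ S, τ q *
        ∏ b ∈ B.erase q.1, (c b + ∑ p ∈ S with p.1 = b ∧ ℓ q ≤ ℓ p, τ p) := by
  -- The new element `a` has the least label: its own term carries no restriction, and no older term
  -- sees it.
  induction S using Finset.induction_on_min_value ℓ with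
  | empty => simp
  | insert a S ha hmin ih =>
    have hlt : ∀ q ∈ S, ℓ a < ℓ q := fun q hq =>
      lt_of_le_of_ne (hmin q hq) fun h => ha <| by
        have := hℓ (Finset.mem_insert_self a S) (Finset.mem_insert_of_mem hq) h
        exact this ▸ hq
    have haB : a.1 ∈ B := hS a (Finset.mem_insert_self _ _)
    have ih := ih (fun p hp => hS p (Finset.mem_insert_of_mem hp))
      (hℓ.mono (Finset.coe_subset.2 (Finset.subset_insert _ _)))
    have hother : ∀ b ∈ B.erase a.1, (c b + ∑ p ∈ insert a S with p.1 = b, τ p) =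
        c b + ∑ p ∈ S with p.1 = b, τ p := by
      intro b hb
      rw [Finset.filter_insert, if_neg (Finset.ne_of_mem_erase hb).symm]
    have hsame : ∀ b ∈ B.erase a.1,
        (c b + ∑ p ∈ insert a S with p.1 = b ∧ ℓ a ≤ ℓ p, τ p) =
        c b + ∑ p ∈ S with p.1 = b, τ p := by
      intro b hb
      rw [Finset.filter_insert, if_neg (fun h => (Finset.ne_of_mem_erase hb).symm h.1)]
      congr 2
      exact Finset.filter_congr fun p hp => and_iff_left (hmin p hp)
    have hrest : ∀ q ∈ S, (τ q *
        ∏ b ∈ B.erase q.1, (c b + ∑ p ∈ insert a S with p.1 = b ∧ ℓ q ≤ ℓ p, τ p)) =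
        τ q * ∏ b ∈ B.erase q.1, (c b + ∑ p ∈ S with p.1 = b ∧ ℓ q ≤ ℓ p, τ p) := by
      intro q hq
      congr 1
      refine Finset.prod_congr rfl fun b _ => ?_
      rw [Finset.filter_insert, if_neg (fun h => (hlt q hq).not_ge h.2)]
    rw [Finset.sum_insert ha, Finset.sum_congr rfl hrest, Finset.prod_congr rfl hsame,
      ← Finset.mul_prod_erase B _ haB, Finset.prod_congr rfl hother, Finset.filter_insert,
      if_pos rfl, Finset.sum_insert (fun h => ha (Finset.mem_filter.1 h).1)]
    rw [← Finset.mul_prod_erase B _ haB] at ih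
    calc _ = τ a * ∏ b ∈ B.erase a.1, (c b + ∑ p ∈ S with p.1 = b, τ p) +
          (c a.1 + ∑ p ∈ S with p.1 = a.1, τ p) *
            ∏ b ∈ B.erase a.1, (c b + ∑ p ∈ S with p.1 = b, τ p) := by ring
      _ = _ := by rw [ih]; ring

/-! ### Decreasing chains below an element of a labeled poset -/

section LabeledChains

variable {P L : Type*} [PartialOrder P] [LinearOrder L]

/-- `S` is a maximal chain of the lower interval of `x`. -/
def IsMaxChainBelow (x : P) (S : Set P) : Prop :=
  IsChain (· ≤ ·) S ∧ (∀ y ∈ S, y ≤ x) ∧ ∀ z ≤ x, (∀ y ∈ S, y ≤ z ∨ z ≤ y) → z ∈ S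

/-- The maximal chains below `x` along which the labels weakly decrease, and whose coatom
satisfies `p`. -/
def decreasingChainsBelow (lab : P → P → L) (x : P) (p : P → Prop) : Set (Set P) :=
  {S | IsMaxChainBelow x S ∧
    (∀ a ∈ S, ∀ b ∈ S, ∀ c ∈ S, a ⋖ b → b ⋖ c → lab b c ≤ lab a b) ∧ ∀ y ∈ S, y ⋖ x → p y}

theorem IsMaxChainBelow.self_mem {x : P} {S : Set P} (h : IsMaxChainBelow x S) : x ∈ S :=
  h.2.2 x le_rfl fun y hy => Or.inl (h.2.1 y hy)

theorem IsMaxChainBelow.exists_covBy [OrderBot P] [Finite P] {x : P} {S : Set P}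
    (h : IsMaxChainBelow x S) (hx : x ≠ ⊥) :
    ∃ y ∈ S, y ⋖ x ∧ ∀ z ∈ S, z ≠ x → z ≤ y := by
  have hbot : ⊥ ∈ S \ {x} := ⟨h.2.2 ⊥ bot_le fun y _ => Or.inr bot_le, fun e => hx e.symm⟩
  obtain ⟨y, hy, hmax⟩ := (Set.toFinite (S \ {x})).exists_maximal ⟨_, hbot⟩
  have hgr : ∀ z ∈ S, z ≠ x → z ≤ y := fun z hz hzx =>
    (h.1.total hz hy.1).elim id fun hyz => hmax ⟨hz, hzx⟩ hyz
  have hlt : y < x := lt_of_le_of_ne (h.2.1 y hy.1) hy.2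
  refine ⟨y, hy.1, ⟨hlt, fun z hyz hzx => ?_⟩, hgr⟩
  have hz : z ∈ S := h.2.2 z hzx.le fun u hu => by
    by_cases hux : u = x
    · exact Or.inr (hux ▸ hzx.le)
    · exact Or.inl ((hgr u hu hux).trans hyz.le)
  exact (hgr z hz hzx.ne).not_gt hyz

theorem IsMaxChainBelow.insert {x y : P} {S : Set P} (h : IsMaxChainBelow y S) (hyx : y ⋖ x) :
    IsMaxChainBelow x (insert x S) := by
  refine ⟨h.1.insert fun b hb _ => Or.inr ((h.2.1 b hb).trans hyx.le), ?_, ?_⟩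
  · rintro z (rfl | hz)
    · exact le_rfl
    · exact (h.2.1 z hz).trans hyx.le
  · intro z hzx hz
    rcases hz y (Or.inr h.self_mem) with hyz | hzy
    · rcases hyx.eq_or_eq hyz hzx with rfl | rfl
      · exact Or.inr h.self_mem
      · exact Or.inl rfl
    · exact Or.inr (h.2.2 z hzy fun u hu => hz u (Or.inr hu))

theorem IsMaxChainBelow.diff {x y : P} {S : Set P} (h : IsMaxChainBelow x S)
    (hyx : y ⋖ x) (hgr : ∀ z ∈ S, z ≠ x → z ≤ y) : IsMaxChainBelow y (S \ {x}) := by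
  refine ⟨h.1.mono Set.sdiff_subset, fun z hz => hgr z hz.1 hz.2, fun z hzy hz => ⟨?_, ?_⟩⟩
  · refine h.2.2 z (hzy.trans hyx.le) fun u hu => ?_
    by_cases hux : u = x
    · exact Or.inr (hux ▸ hzy.trans hyx.le)
    · exact hz u ⟨hu, hux⟩
  · rintro rfl
    exact hyx.lt.not_ge hzy

theorem ncard_decreasingChainsBelow_bot [OrderBot P] (lab : P → P → L) (p : P → Prop) :
    (decreasingChainsBelow lab ⊥ p).ncard = 1 := by
  rw [Set.ncard_eq_one]
  refine ⟨{⊥}, Set.eq_singleton_iff_unique_mem.2 ⟨⟨⟨?_, ?_, ?_⟩, ?_, ?_⟩, ?_⟩⟩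
  · exact Set.subsingleton_singleton.isChain
  · rintro y rfl
    exact le_rfl
  · intro z hz _
    exact le_bot_iff.1 hz
  · rintro a rfl b rfl c rfl hab
    exact absurd hab.lt (lt_irrefl _)
  · intro y _ hy
    exact absurd hy.lt not_lt_bot
  · intro S hS
    exact Set.eq_singleton_iff_unique_mem.2 ⟨hS.1.self_mem, fun z hz => le_bot_iff.1 (hS.1.2.1 z hz)⟩

open Classical in
-- Removing `x` from a chain leaves a maximal chain below its unique coatom `y`. The decrease
-- condition at `y` becomes the bound `lab y x` on the next edge, which is why a predicate on the
-- coatom is carried along.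
theorem ncard_decreasingChainsBelow [OrderBot P] [Fintype P] (lab : P → P → L) {x : P}
    (hx : x ≠ ⊥) (p : P → Prop) [DecidablePred p] :
    (decreasingChainsBelow lab x p).ncard = ∑ y with y ⋖ x ∧ p y,
      (decreasingChainsBelow lab y fun z => lab y x ≤ lab z y).ncard := by
  rw [← Finset.sum_coe_sort]
  simp only [← Nat.card_coe_set_eq]
  rw [← Nat.card_sigma]
  symm
  let F : (Σ y : ↥(Finset.univ.filter fun y => y ⋖ x ∧ p y),
      decreasingChainsBelow lab y.1 fun z => lab y.1 x ≤ lab z y.1) →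
      decreasingChainsBelow lab x p := fun a => ⟨insert x a.2.1, by
    obtain ⟨⟨y, hy⟩, S, hS, hdec, hp⟩ := a
    obtain ⟨-, hyx, hpy⟩ := Finset.mem_filter.1 hy
    have hlt : ∀ z ∈ S, z < x := fun z hz => (hS.2.1 z hz).trans_lt hyx.lt
    have heq : ∀ z ∈ S, z ⋖ x → z = y := fun z hz hzx =>
      ((hzx.eq_or_eq (hS.2.1 z hz) hyx.le).resolve_right hyx.lt.ne).symm
    refine ⟨hS.insert hyx, ?_, ?_⟩
    · intro a ha b hb c hc hab hbc
      rcases hb with rfl | hb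
      · rcases hc with rfl | hc
        · exact absurd hbc.lt (lt_irrefl _)
        · exact absurd hbc.lt (hlt c hc).not_gt
      rcases ha with rfl | ha
      · exact absurd hab.lt (hlt b hb).not_gt
      rcases hc with rfl | hc
      · obtain rfl := heq b hb hbc
        exact hp a ha hab
      · exact hdec a ha b hb c hc hab hbc
    · rintro z (rfl | hz) hzx
      · exact absurd hzx.lt (lt_irrefl _)
      · exact (heq z hz hzx) ▸ hpy⟩
  refine Nat.card_eq_of_bijective F ⟨?_, ?_⟩
  · rintro ⟨⟨y, hy⟩, S, hS⟩ ⟨⟨y', hy'⟩, S', hS'⟩ h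
    have hyx := (Finset.mem_filter.1 hy).2.1
    have hyx' := (Finset.mem_filter.1 hy').2.1
    have h : insert x S = insert x S' := congrArg Subtype.val h
    have hxS : x ∉ S := fun hxS => (hS.1.2.1 x hxS).not_gt hyx.lt
    have hxS' : x ∉ S' := fun hxS' => (hS'.1.2.1 x hxS').not_gt hyx'.lt
    obtain rfl : S = S' := by
      rw [← Set.insert_sdiff_self_of_notMem hxS, h, Set.insert_sdiff_self_of_notMem hxS']
    obtain rfl : y = y' := le_antisymm (hS'.1.2.1 y hS.1.self_mem) (hS.1.2.1 y' hS'.1.self_mem)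
    rfl
  · rintro ⟨T, hT, hdec, hp⟩
    obtain ⟨y, hy, hyx, hgr⟩ := hT.exists_covBy hx
    refine ⟨⟨⟨y, Finset.mem_filter.2 ⟨Finset.mem_univ _, hyx, hp y hy hyx⟩⟩, T \ {x},
      hT.diff hyx hgr, ?_, ?_⟩, ?_⟩
    · exact fun a ha b hb c hc => hdec a ha.1 b hb.1 c hc.1
    · exact fun z hz hzy => hdec z hz.1 y hy x hT.self_mem hzy hyx
    · exact Subtype.ext (Set.insert_sdiff_self_of_mem hT.self_mem)

theorem Flag.isMaxChainBelow {t : P} (ht : ∀ z, z ≤ t) (C : Flag P) :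
    IsMaxChainBelow t (C : Set P) := by
  refine ⟨C.chain_le, fun y _ => ht y, fun z _ hz => ?_⟩
  exact C.mem_iff_forall_le_or_ge.2 fun y hy => (hz y hy).symm

theorem IsMaxChainBelow.isMaxChain {t : P} (ht : ∀ z, z ≤ t) {S : Set P}
    (h : IsMaxChainBelow t S) : IsMaxChain (· ≤ ·) S := by
  refine ⟨h.1, fun T hT hST => hST.antisymm fun z hz => ?_⟩
  exact h.2.2 z (ht z) fun y hy => hT.total (hST hy) hz

end LabeledChains

theorem ncard_decreasingChains {n s : ℕ} {t : VectorPartitionPoset n s} (ht : ∀ z, z ≤ t) :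
    (decreasingChains n s).ncard =
      (decreasingChainsBelow edgeLabel t fun _ => True).ncard := by
  rw [← Set.ncard_image_of_injective _ (SetLike.coe_injective (A := Flag (VectorPartitionPoset n s)))]
  congr 1
  ext S
  constructor
  · rintro ⟨C, hC, rfl⟩
    exact ⟨C.isMaxChainBelow ht, fun a ha b hb c hc => hC a ha b hb c hc, fun _ _ _ => trivial⟩
  · rintro ⟨hS, hdec, -⟩
    exact ⟨Flag.ofIsMaxChain S (hS.isMaxChain ht), hdec, rfl⟩

theorem ncard_decreasingChainsWithTop {n s : ℕ} (i : ℕ) {t : VectorPartitionPoset n s}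
    (ht : ∀ z, z ≤ t) (ht' : t ≠ ⊥) :
    (decreasingChainsWithTop n s i).ncard =
      (decreasingChainsBelow edgeLabel t fun y => (edgeLabel y t).middle = i).ncard := by
  rw [← Set.ncard_image_of_injective _ (SetLike.coe_injective (A := Flag (VectorPartitionPoset n s)))]
  congr 1
  ext S
  constructor
  · rintro ⟨C, ⟨hC, x, hx, y, hy, hxy, hmax, hi⟩, rfl⟩
    have hC' := C.isMaxChainBelow ht
    obtain rfl : y = t := le_antisymm (ht y) (hmax t hC'.self_mem)
    refine ⟨hC', fun a ha b hb c hc => hC a ha b hb c hc, fun z hz hzy => ?_⟩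
    have : z = x := by
      rcases C.chain_le.total hz hx with h | h
      · exact ((hzy.eq_or_eq h hxy.le).resolve_right hxy.lt.ne).symm
      · exact (hxy.eq_or_eq h hzy.le).resolve_right hzy.lt.ne
    exact this ▸ hi
  · rintro ⟨hS, hdec, hp⟩
    obtain ⟨y, hy, hyt, -⟩ := hS.exists_covBy ht'
    exact ⟨Flag.ofIsMaxChain S (hS.isMaxChain ht), ⟨hdec, y, hy, t, hS.self_mem, hyt,
      fun z _ => ht z, hp y hy hyt⟩, rfl⟩

/-! ### The lexicographically first atom -/

namespace VectorPartition

variable {n s : ℕ}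

/-- The atom that is identified with a word all of whose rows are injective. -/
def ofWord (w : AtomWord n s) (hw : ∀ i, Function.Injective (w.letter i)) :
    VectorPartition n s where
  blocks := Finset.univ.image
    (fun k : Fin n => (Fin.cons {k} (fun i => {w.letter i k}) : Fin (s + 1) → Finset (Fin n)))
  nonempty := by
    intro b hb
    obtain ⟨k, -, rfl⟩ := Finset.mem_image.1 hb
    exact ⟨k, Finset.mem_singleton_self k⟩
  card_eq := by
    intro b hb h
    obtain ⟨k, -, rfl⟩ := Finset.mem_image.1 hb
    refine Fin.cases rfl (fun i => ?_) h
    simp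
  partition := by
    intro h x
    refine Fin.cases ?_ (fun i => ?_) h
    · refine ⟨_, ⟨Finset.mem_image_of_mem _ (Finset.mem_univ x), by simp⟩, ?_⟩
      rintro b ⟨hb, hx⟩
      obtain ⟨k, -, rfl⟩ := Finset.mem_image.1 hb
      rw [Finset.mem_singleton.1 (show x ∈ ({k} : Finset (Fin n)) from hx)]
    · obtain ⟨k, rfl⟩ := (Finite.injective_iff_surjective.1 (hw i)) x
      refine ⟨_, ⟨Finset.mem_image_of_mem _ (Finset.mem_univ k), by simp⟩, ?_⟩
      rintro b ⟨hb, hx⟩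
      obtain ⟨k', -, rfl⟩ := Finset.mem_image.1 hb
      rw [Fin.cons_succ, Finset.mem_singleton] at hx
      rw [hw i hx]

theorem mem_atomWordsBelow {X : VectorPartition n s} {w : AtomWord n s} :
    w ∈ X.atomWordsBelow ↔ (∀ i, Function.Injective (w.letter i)) ∧
      ∀ b ∈ X.blocks, ∀ k ∈ b 0, ∀ i : Fin s, w.letter i k ∈ b i.succ := by
  simp only [atomWordsBelow, Finset.mem_filter, Finset.mem_univ, true_and]
  constructor
  · rintro ⟨a, ha, haX⟩
    have hmem : ∀ k : Fin n, (Fin.cons {k} (fun i => {w.letter i k}) :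
        Fin (s + 1) → Finset (Fin n)) ∈ a.blocks := fun k => by
      rw [ha]
      exact Finset.mem_image_of_mem _ (Finset.mem_univ k)
    constructor
    · intro i k k' hkk
      have := a.blocks_eq (hmem k) (hmem k') (h := i.succ) (x := w.letter i k) (by simp)
        (by simp [hkk])
      simpa using congrFun this 0
    · intro b hb k hk i
      obtain ⟨c, hc, hsub⟩ := (le_iff a X).1 haX _ (hmem k)
      have hkc : k ∈ c 0 := hsub 0 (by simp)
      obtain rfl := X.blocks_eq hb hc hk hkc
      exact hsub i.succ (by simp)
  · rintro ⟨hinj, hw⟩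
    refine ⟨ofWord w hinj, rfl, (le_iff _ X).2 fun b hb => ?_⟩
    obtain ⟨k, -, rfl⟩ := Finset.mem_image.1 hb
    obtain ⟨c, ⟨hc, hkc⟩, -⟩ := X.partition 0 k
    refine ⟨c, hc, fun h => Fin.cases ?_ (fun i => ?_) h⟩
    · simpa using hkc
    · simpa using hw c hc k hkc i

theorem atomWord_injective (X : VectorPartition n s) (i : Fin s) :
    Function.Injective (X.atomWord.letter i) :=
  (mem_atomWordsBelow.1 (X.atomWordsBelow.min'_mem X.atomWordsBelow_nonempty)).1 i

theorem atomWord_mem (X : VectorPartition n s) {b : Fin (s + 1) → Finset (Fin n)}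
    (hb : b ∈ X.blocks) {k : Fin n} (hk : k ∈ b 0) (i : Fin s) :
    X.atomWord.letter i k ∈ b i.succ :=
  (mem_atomWordsBelow.1 (X.atomWordsBelow.min'_mem X.atomWordsBelow_nonempty)).2 b hb k hk i

theorem exists_atomWord_eq (X : VectorPartition n s) {b : Fin (s + 1) → Finset (Fin n)}
    (hb : b ∈ X.blocks) (i : Fin s) {y : Fin n} (hy : y ∈ b i.succ) :
    ∃ k ∈ b 0, X.atomWord.letter i k = y := by
  obtain ⟨k, rfl⟩ := (Finite.injective_iff_surjective.1 (X.atomWord_injective i)) y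
  obtain ⟨c, ⟨hc, hkc⟩, -⟩ := X.partition 0 k
  obtain rfl := X.blocks_eq hb hc hy (X.atomWord_mem hc hkc i)
  exact ⟨k, hkc, rfl⟩

/-- An inversion inside a block could be removed by swapping the two letters, which gives an earlier
atom still below `X`. -/
theorem atomWord_strictMonoOn (X : VectorPartition n s) {b : Fin (s + 1) → Finset (Fin n)}
    (hb : b ∈ X.blocks) (i : Fin s) : StrictMonoOn (X.atomWord.letter i) (b 0) := by
  intro k hk k' hk' hlt
  by_contra hnot
  have hk : k ∈ b 0 := hk
  have hk' : k' ∈ b 0 := hk'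
  set w := X.atomWord with hw
  have hgt : w.letter i k' < w.letter i k :=
    lt_of_le_of_ne (not_lt.1 hnot) fun h => hlt.ne' (X.atomWord_injective i h)
  let w' : AtomWord n s := toLex fun p => w.letter (ofLex p).1
    (if (ofLex p).1 = i then Equiv.swap k k' (ofLex p).2 else (ofLex p).2)
  have hi : ∀ x, w'.letter i x = w.letter i (Equiv.swap k k' x) := fun x => by
    simp [w', AtomWord.letter]
  have hne : ∀ j, j ≠ i → ∀ x, w'.letter j x = w.letter j x := fun j hj x => by
    simp [w', AtomWord.letter, hj]
  have hmem : w' ∈ X.atomWordsBelow := by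
    refine mem_atomWordsBelow.2 ⟨fun j => ?_, fun c hc x hx j => ?_⟩
    · by_cases hj : j = i
      · subst hj
        intro x y hxy
        rw [hi, hi] at hxy
        exact (Equiv.swap k k').injective (X.atomWord_injective j hxy)
      · intro x y hxy
        rw [hne j hj, hne j hj] at hxy
        exact X.atomWord_injective j hxy
    · by_cases hj : j = i
      · subst hj
        rw [hi]
        refine X.atomWord_mem hc ?_ j
        rcases eq_or_ne x k with rfl | hxk
        · rw [Equiv.swap_apply_left]
          exact X.blocks_eq hb hc hk hx ▸ hk'
        rcases eq_or_ne x k' with rfl | hxk'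
        · rw [Equiv.swap_apply_right]
          exact X.blocks_eq hb hc hk' hx ▸ hk
        · rwa [Equiv.swap_apply_of_ne_of_ne hxk hxk']
      · rw [hne j hj]
        exact X.atomWord_mem hc hx j
  -- The words first differ at `(i, k)`, where the swap puts the smaller letter.
  have hlt' : w' < w := by
    refine ⟨toLex (i, k), fun p hp => ?_, ?_⟩
    · obtain ⟨j, x, rfl⟩ : ∃ j x, p = toLex (j, x) := ⟨(ofLex p).1, (ofLex p).2, rfl⟩
      change w'.letter j x = w.letter j x
      rcases Prod.Lex.toLex_lt_toLex.1 hp with h | ⟨h, hx⟩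
      · exact hne j (ne_of_lt h) x
      · simp only at h hx
        subst h
        rw [hi, Equiv.swap_apply_of_ne_of_ne hx.ne (hx.trans hlt).ne]
    · change w'.letter i k < w.letter i k
      rwa [hi, Equiv.swap_apply_left]
  exact (X.atomWordsBelow.min'_le w' hmem).not_gt hlt'

/-- On a block, both words give the increasing bijection from the part to its label, and this
depends only on the block. -/
theorem atomWord_letter_eq {X Y : VectorPartition n s} {b : Fin (s + 1) → Finset (Fin n)}
    (hX : b ∈ X.blocks) (hY : b ∈ Y.blocks) (i : Fin s) {k : Fin n} (hk : k ∈ b 0) :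
    X.atomWord.letter i k = Y.atomWord.letter i k := by
  induction k using WellFoundedLT.induction with
  | ind k ih =>
    have key : ∀ {X Y : VectorPartition n s}, b ∈ X.blocks → b ∈ Y.blocks →
        (∀ m < k, m ∈ b 0 → X.atomWord.letter i m = Y.atomWord.letter i m) →
        Y.atomWord.letter i k ≤ X.atomWord.letter i k := by
      intro X Y hX hY ih
      obtain ⟨m, hm, hmk⟩ := Y.exists_atomWord_eq hY i (X.atomWord_mem hX hk i)
      rw [← hmk]
      refine (Y.atomWord_strictMonoOn hY i).monotoneOn hk hm (not_lt.1 fun hlt => ?_)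
      rw [← ih m hlt hm] at hmk
      exact hlt.ne (X.atomWord_injective i hmk)
    exact le_antisymm (key hY hX fun m hm hmb => (ih m hm hmb).symm) (key hX hY ih)

theorem atomWord_le_of_le {X Y : VectorPartition n s} (h : Y ≤ X) : X.atomWord ≤ Y.atomWord := by
  refine X.atomWordsBelow.min'_le _ (mem_atomWordsBelow.2 ⟨Y.atomWord_injective, ?_⟩)
  intro b hb k hk i
  obtain ⟨c, ⟨hc, hkc⟩, -⟩ := Y.partition 0 k
  obtain ⟨d, hd, hsub⟩ := (le_iff Y X).1 h c hc
  obtain rfl := X.blocks_eq hb hd hk (hsub 0 hkc)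
  exact hsub _ (Y.atomWord_mem hc hkc i)

end VectorPartition

/-- The least element of a nonempty set, as a natural number. -/
def Finset.minNat {n : ℕ} (t : Finset (Fin n)) : ℕ := if h : t.Nonempty then (t.min' h : ℕ) else 0

theorem Finset.exists_eq_minNat {n : ℕ} {t : Finset (Fin n)} (h : t.Nonempty) :
    ∃ x ∈ t, (x : ℕ) = t.minNat :=
  ⟨t.min' h, t.min'_mem h, by rw [Finset.minNat, dif_pos h]⟩

theorem Finset.minNat_le {n : ℕ} {t : Finset (Fin n)} {x : Fin n} (h : x ∈ t) :
    t.minNat ≤ x := by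
  rw [Finset.minNat, dif_pos ⟨x, h⟩]
  exact t.min'_le x h

theorem VectorPartition.atomWord_letter_minNat {n s : ℕ} (X : VectorPartition n s)
    {b : Fin (s + 1) → Finset (Fin n)} (hb : b ∈ X.blocks) (i : Fin s) {k : Fin n} (hk : k ∈ b 0)
    (hmin : (k : ℕ) = (b 0).minNat) : (X.atomWord.letter i k : ℕ) = (b i.succ).minNat := by
  refine le_antisymm ?_ (Finset.minNat_le (X.atomWord_mem hb hk i))
  obtain ⟨y, hy, hyb⟩ := Finset.exists_eq_minNat ⟨_, X.atomWord_mem hb hk i⟩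
  obtain ⟨m, hm, rfl⟩ := X.exists_atomWord_eq hb i hy
  rw [← hyb]
  exact (X.atomWord_strictMonoOn hb i).monotoneOn hk hm
    (Fin.le_def.2 (hmin.trans_le (Finset.minNat_le hm)))

/-! ### Lower covers as splittings of a block -/

namespace VectorPartition

variable {n s : ℕ}

/-- `I` is the piece that contains the least element of `b 0` in a splitting of the block `b` into
two blocks. -/
structure IsSplit (b I : Fin (s + 1) → Finset (Fin n)) : Prop where
  subset : ∀ h, I h ⊆ b h
  card_eq : ∀ h, (I h).card = (I 0).card
  exists_min : ∃ x ∈ I 0, (x : ℕ) = (b 0).minNat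
  ne : I 0 ≠ b 0

theorem IsSplit.card_lt {b I : Fin (s + 1) → Finset (Fin n)} (hI : IsSplit b I) :
    (I 0).card < (b 0).card :=
  Finset.card_lt_card ((hI.subset 0).ssubset_of_ne hI.ne)

theorem IsSplit.card_pos {b I : Fin (s + 1) → Finset (Fin n)} (hI : IsSplit b I) (h : Fin (s + 1)) :
    0 < (I h).card := by
  obtain ⟨x, hx, -⟩ := hI.exists_min
  rw [hI.card_eq]
  exact Finset.card_pos.2 ⟨x, hx⟩

theorem IsSplit.nonempty {b I : Fin (s + 1) → Finset (Fin n)} (hI : IsSplit b I)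
    (h : Fin (s + 1)) : (I h).Nonempty :=
  Finset.card_pos.1 (hI.card_pos h)

theorem card_sdiff_of_isSplit (X : VectorPartition n s) {b I : Fin (s + 1) → Finset (Fin n)}
    (hb : b ∈ X.blocks) (hI : IsSplit b I) (h : Fin (s + 1)) :
    ((b \ I) h).card = (b 0).card - (I 0).card := by
  rw [Pi.sdiff_apply, Finset.card_sdiff_of_subset (hI.subset h), X.card_eq b hb, hI.card_eq]

theorem sdiff_nonempty_of_isSplit (X : VectorPartition n s) {b I : Fin (s + 1) → Finset (Fin n)}
    (hb : b ∈ X.blocks) (hI : IsSplit b I) (h : Fin (s + 1)) : ((b \ I) h).Nonempty := by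
  rw [← Finset.card_pos, X.card_sdiff_of_isSplit hb hI]
  exact Nat.sub_pos_of_lt hI.card_lt

open Classical in
/-- The result of splitting the block `b` of `X` into `I` and `b \ I`. -/
noncomputable def split (X : VectorPartition n s) (b I : Fin (s + 1) → Finset (Fin n)) :
    VectorPartition n s :=
  if H : b ∈ X.blocks ∧ IsSplit b I then
    { blocks := insert I (insert (b \ I) (X.blocks.erase b))
      nonempty := by
        intro c hc
        simp only [Finset.mem_insert, Finset.mem_erase] at hc
        rcases hc with rfl | rfl | hc
        · exact H.2.nonempty 0
        · exact X.sdiff_nonempty_of_isSplit H.1 H.2 0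
        · exact X.nonempty c hc.2
      card_eq := by
        intro c hc h
        simp only [Finset.mem_insert, Finset.mem_erase] at hc
        rcases hc with rfl | rfl | hc
        · exact H.2.card_eq h
        · rw [X.card_sdiff_of_isSplit H.1 H.2, X.card_sdiff_of_isSplit H.1 H.2]
        · exact X.card_eq c hc.2 h
      partition := by
        intro h x
        obtain ⟨c, ⟨hc, hxc⟩, huniq⟩ := X.partition h x
        simp only [Finset.mem_insert, Finset.mem_erase]
        by_cases hcb : c = b
        · subst hcb
          by_cases hxI : x ∈ I h
          · refine ⟨I, ⟨Or.inl rfl, hxI⟩, ?_⟩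
            rintro d ⟨rfl | rfl | hd, hxd⟩
            · rfl
            · exact absurd hxI (Finset.mem_sdiff.1 hxd).2
            · exact absurd (huniq d ⟨hd.2, hxd⟩) hd.1
          · refine ⟨c \ I, ⟨Or.inr (Or.inl rfl), Finset.mem_sdiff.2 ⟨hxc, hxI⟩⟩, ?_⟩
            rintro d ⟨rfl | rfl | hd, hxd⟩
            · exact absurd hxd hxI
            · rfl
            · exact absurd (huniq d ⟨hd.2, hxd⟩) hd.1
        · have hxb : x ∉ b h := fun hxb => hcb (huniq b ⟨H.1, hxb⟩).symm
          refine ⟨c, ⟨Or.inr (Or.inr ⟨hcb, hc⟩), hxc⟩, ?_⟩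
          rintro d ⟨rfl | rfl | hd, hxd⟩
          · exact absurd (H.2.subset h hxd) hxb
          · exact absurd (Finset.mem_sdiff.1 hxd).1 hxb
          · exact huniq d ⟨hd.2, hxd⟩ }
  else X

open Classical in
theorem blocks_split (X : VectorPartition n s) {b I : Fin (s + 1) → Finset (Fin n)}
    (hb : b ∈ X.blocks) (hI : IsSplit b I) :
    (X.split b I).blocks = insert I (insert (b \ I) (X.blocks.erase b)) := by
  rw [split, dif_pos ⟨hb, hI⟩]

section

variable {X : VectorPartition n s} {b I : Fin (s + 1) → Finset (Fin n)}

theorem mem_blocks_split (hb : b ∈ X.blocks) (hI : IsSplit b I)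
    {c : Fin (s + 1) → Finset (Fin n)} :
    c ∈ (X.split b I).blocks ↔ c = I ∨ c = b \ I ∨ (c ≠ b ∧ c ∈ X.blocks) := by
  classical
  rw [blocks_split X hb hI, Finset.mem_insert, Finset.mem_insert, Finset.mem_erase]

theorem prod_blocks_split {M : Type*} [CommMonoid M]
    (f : (Fin (s + 1) → Finset (Fin n)) → M) (hb : b ∈ X.blocks) (hI : IsSplit b I) :
    ∏ c ∈ (X.split b I).blocks, f c = f I * f (b \ I) * ∏ c ∈ X.blocks.erase b, f c := by
  classical
  obtain ⟨x, hx⟩ := hI.nonempty 0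
  obtain ⟨y, hy⟩ := X.sdiff_nonempty_of_isSplit hb hI 0
  have hy' := Finset.mem_sdiff.1 hy
  have h1 : b \ I ∉ X.blocks.erase b := fun h =>
    (Finset.mem_erase.1 h).1 (X.blocks_eq (Finset.mem_erase.1 h).2 hb hy hy'.1)
  have h2 : I ∉ insert (b \ I) (X.blocks.erase b) := by
    intro h
    rcases Finset.mem_insert.1 h with h | h
    · rw [h] at hx
      exact (Finset.mem_sdiff.1 hx).2 (h ▸ hx)
    · exact (Finset.mem_erase.1 h).1 (X.blocks_eq (Finset.mem_erase.1 h).2 hb hx (hI.subset 0 hx))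
  rw [blocks_split X hb hI, Finset.prod_insert h2, Finset.prod_insert h1, mul_assoc]

theorem split_lt (hb : b ∈ X.blocks) (hI : IsSplit b I) : X.split b I < X := by
  refine lt_of_le_of_ne ((le_iff _ _).2 fun c hc => ?_) fun h => ?_
  · rcases (mem_blocks_split hb hI).1 hc with rfl | rfl | hc
    · exact ⟨b, hb, hI.subset⟩
    · exact ⟨b, hb, fun h => Finset.sdiff_subset⟩
    · exact ⟨c, hc.2, fun h => Finset.Subset.refl _⟩
  · have hIX : I ∈ X.blocks := by
      rw [← h]
      exact (mem_blocks_split hb hI).2 (Or.inl rfl)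
    obtain ⟨x, hx⟩ := hI.nonempty 0
    exact hI.ne (congrFun (X.blocks_eq hIX hb hx (hI.subset 0 hx)) 0)

/-- Some block `b` of `X` is not a block of `Y`, and `I` is the block of `Y` through the least
element of `b 0`. -/
theorem exists_le_split_of_lt {Y : VectorPartition n s} (h : Y < X) :
    ∃ b ∈ X.blocks, ∃ I, IsSplit b I ∧ Y ≤ X.split b I := by
  obtain ⟨b, hb, hbY⟩ : ∃ b ∈ X.blocks, b ∉ Y.blocks := by
    by_contra! hsub
    refine h.not_ge ((le_iff X Y).2 fun b hb => ⟨b, hsub b hb, fun _ => Finset.Subset.refl _⟩)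
  obtain ⟨x, hx, hxmin⟩ := Finset.exists_eq_minNat (X.nonempty b hb)
  obtain ⟨I, ⟨hIY, hxI⟩, -⟩ := Y.partition 0 x
  have hle := (le_iff Y X).1 h.le
  have hIb : ∀ h, I h ⊆ b h := by
    obtain ⟨c, hc, hIc⟩ := hle I hIY
    obtain rfl := X.blocks_eq hb hc hx (hIc 0 hxI)
    exact hIc
  have hI : IsSplit b I := by
    refine ⟨hIb, Y.card_eq I hIY, ⟨x, hxI, hxmin⟩, fun h0 => hbY ?_⟩
    have : I = b := funext fun h => Finset.eq_of_subset_of_card_le (hIb h) (by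
      rw [X.card_eq b hb, Y.card_eq I hIY, h0])
    exact this ▸ hIY
  refine ⟨b, hb, I, hI, (le_iff _ _).2 fun d hd => ?_⟩
  by_cases hdI : d = I
  · exact ⟨I, (mem_blocks_split hb hI).2 (Or.inl rfl), fun h => hdI ▸ Finset.Subset.refl _⟩
  obtain ⟨e, he, hde⟩ := hle d hd
  by_cases heb : e = b
  · subst heb
    refine ⟨_, (mem_blocks_split hb hI).2 (Or.inr (Or.inl rfl)), fun h z hz => ?_⟩
    exact Finset.mem_sdiff.2 ⟨hde h hz, fun hzI => hdI (Y.blocks_eq hd hIY hz hzI)⟩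
  · exact ⟨e, (mem_blocks_split hb hI).2 (Or.inr (Or.inr ⟨heb, he⟩)), hde⟩

/-- Distinct splittings are incomparable. Hence each one is covered by `X`, and none is counted
twice in `sum_covBy`. -/
theorem eq_of_split_le_split {b' I' : Fin (s + 1) → Finset (Fin n)} (hb : b ∈ X.blocks)
    (hI : IsSplit b I) (hb' : b' ∈ X.blocks) (hI' : IsSplit b' I')
    (h : X.split b I ≤ X.split b' I') : b = b' ∧ I = I' := by
  have hle := (le_iff _ _).1 h
  -- a block of the coarser splitting that meets the split block is one of the two pieces
  have hmeet : ∀ c ∈ (X.split b' I').blocks, ∀ h, ∀ x ∈ c h, x ∈ b' h → c = I' ∨ c = b' \ I' := by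
    intro c hc h x hx hxb
    rcases (mem_blocks_split hb' hI').1 hc with hc | hc | hc
    · exact Or.inl hc
    · exact Or.inr hc
    · exact absurd (X.blocks_eq hc.2 hb' hx hxb) hc.1
  obtain ⟨x', hx', hxmin'⟩ := hI'.exists_min
  obtain ⟨y', hy'⟩ := X.sdiff_nonempty_of_isSplit hb' hI' 0
  obtain rfl : b = b' := by
    by_contra hne
    obtain ⟨c, hc, hbc⟩ := hle b' ((mem_blocks_split hb hI).2 (Or.inr (Or.inr ⟨Ne.symm hne, hb'⟩)))
    have hxc := hbc 0 (hI'.subset 0 hx')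
    have hyc := hbc 0 (Finset.mem_sdiff.1 hy').1
    rcases hmeet c hc 0 x' hxc (hI'.subset 0 hx') with rfl | rfl
    · exact (Finset.mem_sdiff.1 hy').2 hyc
    · exact (Finset.mem_sdiff.1 hxc).2 hx'
  refine ⟨rfl, ?_⟩
  obtain ⟨x, hx, hxmin⟩ := hI.exists_min
  obtain rfl : x = x' := Fin.ext (hxmin.trans hxmin'.symm)
  have hII' : ∀ h, I h ⊆ I' h := by
    obtain ⟨c, hc, hsub⟩ := hle I ((mem_blocks_split hb hI).2 (Or.inl rfl))
    rcases hmeet c hc 0 x (hsub 0 hx) (hI.subset 0 hx) with rfl | rfl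
    · exact hsub
    · exact absurd hx' (Finset.mem_sdiff.1 (hsub 0 hx)).2
  obtain ⟨c, hc, hsub⟩ := hle (b \ I) ((mem_blocks_split hb hI).2 (Or.inr (Or.inl rfl)))
  obtain ⟨y, hy⟩ := X.sdiff_nonempty_of_isSplit hb hI 0
  have hc' : c = b \ I' := by
    rcases hmeet c hc 0 y (hsub 0 hy) (Finset.mem_sdiff.1 hy).1 with rfl | h
    · exfalso
      have hyI : y' ∈ I 0 := by
        by_contra hyI
        exact (Finset.mem_sdiff.1 hy').2 (hsub 0 (Finset.mem_sdiff.2 ⟨(Finset.mem_sdiff.1 hy').1, hyI⟩))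
      exact (Finset.mem_sdiff.1 hy').2 (hII' 0 hyI)
    · exact h
  subst hc'
  refine funext fun h => Finset.Subset.antisymm (hII' h) fun z hz => ?_
  by_contra hzI
  exact (Finset.mem_sdiff.1 (hsub h (Finset.mem_sdiff.2 ⟨hI'.subset h hz, hzI⟩))).2 hz

theorem split_covBy (hb : b ∈ X.blocks) (hI : IsSplit b I) : X.split b I ⋖ X := by
  refine ⟨split_lt hb hI, fun Z hZ hZX => ?_⟩
  obtain ⟨b', hb', I', hI', hle⟩ := exists_le_split_of_lt hZX
  obtain ⟨rfl, rfl⟩ := eq_of_split_le_split hb hI hb' hI' (hZ.le.trans hle)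
  exact hZ.not_ge hle

theorem exists_eq_split_of_covBy {Y : VectorPartition n s} (h : Y ⋖ X) :
    ∃ b ∈ X.blocks, ∃ I, IsSplit b I ∧ X.split b I = Y := by
  obtain ⟨b, hb, I, hI, hle⟩ := exists_le_split_of_lt h.lt
  exact ⟨b, hb, I, hI, (h.eq_or_eq hle (split_lt hb hI).le).resolve_right (split_lt hb hI).ne⟩

end

noncomputable instance : Fintype (VectorPartition n s) := Fintype.ofFinite _

open Classical in
theorem sum_covBy (X : VectorPartition n s) {M : Type*} [AddCommMonoid M]
    (f : VectorPartition n s → M) :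
    ∑ Y with Y ⋖ X, f Y = ∑ b ∈ X.blocks, ∑ I with IsSplit b I, f (X.split b I) := by
  rw [Finset.sum_sigma']
  symm
  refine Finset.sum_nbij (fun p => X.split p.1 p.2) ?_ ?_ ?_ fun _ _ => rfl
  · rintro ⟨b, I⟩ h
    simp only [Finset.mem_sigma, Finset.mem_filter, Finset.mem_univ, true_and] at h ⊢
    exact split_covBy h.1 h.2
  · rintro ⟨b, I⟩ h ⟨b', I'⟩ h' heq
    simp only [Finset.coe_sigma, Set.mem_sigma_iff, Finset.mem_coe, Finset.mem_filter,
      Finset.mem_univ, true_and] at h h'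
    obtain ⟨rfl, rfl⟩ := eq_of_split_le_split h.1 h.2 h'.1 h'.2 heq.le
    rfl
  · intro Y hY
    simp only [Finset.coe_filter, Finset.mem_univ, true_and, Set.mem_ofPred_eq] at hY
    obtain ⟨b, hb, I, hI, rfl⟩ := exists_eq_split_of_covBy hY
    exact ⟨⟨b, I⟩, by simp [hb, hI], rfl⟩

end VectorPartition

/-! ### Labels of the covers -/

theorem EdgeLabel.mk_le_mk {k i j k' i' j' : ℤ} :
    EdgeLabel.mk k i j ≤ EdgeLabel.mk k' i' j' ↔
      k < k' ∨ k = k' ∧ (i < i' ∨ i = i' ∧ j ≤ j') := by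
  rw [EdgeLabel.mk, EdgeLabel.mk, Prod.Lex.toLex_le_toLex, Prod.Lex.toLex_le_toLex]

theorem EdgeLabel.mk_lt_mk {k i j k' i' j' : ℤ} :
    EdgeLabel.mk k i j < EdgeLabel.mk k' i' j' ↔
      k < k' ∨ k = k' ∧ (i < i' ∨ i = i' ∧ j < j') := by
  rw [EdgeLabel.mk, EdgeLabel.mk, Prod.Lex.toLex_lt_toLex, Prod.Lex.toLex_lt_toLex]

theorem Finset.minNat_eq_of_mem {n : ℕ} {t u : Finset (Fin n)} (hut : u ⊆ t) {x : Fin n}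
    (hx : x ∈ u) (hxt : (x : ℕ) = t.minNat) : u.minNat = t.minNat := by
  obtain ⟨y, hy, hyu⟩ := Finset.exists_eq_minNat ⟨x, hx⟩
  exact le_antisymm (hxt ▸ Finset.minNat_le hx) (hyu ▸ Finset.minNat_le (hut hy))

theorem Finset.minNat_mono {n : ℕ} {t u : Finset (Fin n)} (hut : u ⊆ t) (hu : u.Nonempty) :
    t.minNat ≤ u.minNat := by
  obtain ⟨y, hy, hyu⟩ := Finset.exists_eq_minNat hu
  exact hyu ▸ Finset.minNat_le (hut hy)

namespace VectorPartition

variable {n s : ℕ}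

/-- The label `(k, i, j)`, where `k` is the least element of the part of the block `b` and `j` the
least element of its `i`th label. -/
def minLabel (b : Fin (s + 1) → Finset (Fin n)) (i : Fin s) : EdgeLabel :=
  EdgeLabel.mk (((b 0).minNat : ℤ) + 1) ((i : ℤ) + 1) (((b i.succ).minNat : ℤ) + 1)

theorem edgeLabel_of_ne {X Y : VectorPartition n s} (h : X.atomWord ≠ Y.atomWord) :
    edgeLabel (X : VectorPartitionPoset n s) Y =
      (X.atomWord.differences Y.atomWord).min' (AtomWord.differences_nonempty h) :=
  dif_pos h

theorem edgeLabel_of_eq {X Y : VectorPartition n s} (h : X.atomWord = Y.atomWord) :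
    edgeLabel (X : VectorPartitionPoset n s) Y = EdgeLabel.mk n (X.mergedMax Y) 0 :=
  dif_neg (not_not_intro h)

theorem edgeLabel_bot (X : VectorPartition n s) :
    edgeLabel (⊥ : VectorPartitionPoset n s) X =
      EdgeLabel.mk ((n : ℤ) - 1) ((s : ℤ) + X.atomRank) 0 :=
  rfl

theorem mem_differences {w w' : AtomWord n s} {l : EdgeLabel} :
    l ∈ w.differences w' ↔ ∃ k i, w.letter i k ≠ w'.letter i k ∧
      l = EdgeLabel.mk ((k : ℤ) + 1) ((i : ℤ) + 1) ((w'.letter i k : ℤ) + 1) := by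
  simp only [AtomWord.differences, Finset.mem_image, Finset.mem_filter, Finset.mem_univ, true_and,
    Prod.exists]
  exact exists_congr fun k => exists_congr fun i => and_congr_right fun _ => eq_comm

/-- The threshold `(n - 1, s + 1, 0)` separates edges that change the first atom from bottom edges,
whose labels are at least this large by `edgeLabel_bot_ge`. -/
theorem edgeLabel_lt_of_ne {X Y : VectorPartition n s} (h : X.atomWord ≠ Y.atomWord) :
    edgeLabel (X : VectorPartitionPoset n s) Y < EdgeLabel.mk ((n : ℤ) - 1) ((s : ℤ) + 1) 0 := by
  rw [edgeLabel_of_ne h]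
  obtain ⟨l, hl⟩ := AtomWord.differences_nonempty h
  obtain ⟨k, i, hki, -⟩ := mem_differences.1 hl
  obtain ⟨k', hk', hk'i⟩ : ∃ k' : Fin n, (k' : ℕ) + 1 < n ∧
      X.atomWord.letter i k' ≠ Y.atomWord.letter i k' := by
    -- Rows are permutations: if they differ at the last position, the letter of `Y` there occurs in
    -- `X` at an earlier position, where the rows differ too.
    by_cases hk : (k : ℕ) + 1 < n
    · exact ⟨k, hk, hki⟩
    · obtain ⟨m, hm⟩ := (Finite.injective_iff_surjective.1 (X.atomWord_injective i))
        (Y.atomWord.letter i k)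
      have hmk : m ≠ k := fun e => hki (e ▸ hm)
      refine ⟨m, ?_, fun e => hmk (Y.atomWord_injective i (e.symm.trans hm))⟩
      have := Fin.val_ne_of_ne hmk
      omega
  refine (Finset.min'_le _ _ (mem_differences.2 ⟨k', i, hk'i, rfl⟩)).trans_lt ?_
  rw [EdgeLabel.mk_lt_mk]
  omega

theorem edgeLabel_bot_ge {X : VectorPartition n s} (h : (⊥ : VectorPartitionPoset n s) ⋖ X) :
    EdgeLabel.mk ((n : ℤ) - 1) ((s : ℤ) + 1) 0 ≤ edgeLabel (⊥ : VectorPartitionPoset n s) X := by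
  have : 0 < X.atomRank := (Set.ncard_pos (Set.toFinite _)).2 ⟨X, bot_covBy_iff.1 h, le_rfl⟩
  rw [edgeLabel_bot, EdgeLabel.mk_le_mk]
  omega

section

variable {X : VectorPartition n s} {b I : Fin (s + 1) → Finset (Fin n)}

theorem IsSplit.minNat_eq (hI : IsSplit b I) : (I 0).minNat = (b 0).minNat := by
  obtain ⟨x, hx, hxb⟩ := hI.exists_min
  exact Finset.minNat_eq_of_mem (hI.subset 0) hx hxb

theorem IsSplit.minNat_sdiff_gt (hI : IsSplit b I) (h : ((b \ I) 0).Nonempty) :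
    (b 0).minNat < ((b \ I) 0).minNat := by
  obtain ⟨x, hx, hxb⟩ := hI.exists_min
  obtain ⟨y, hy, hyb⟩ := Finset.exists_eq_minNat h
  rw [← hyb]
  refine lt_of_le_of_ne (Finset.minNat_le (Finset.mem_sdiff.1 hy).1) fun e => ?_
  rw [← hxb] at e
  exact (Finset.mem_sdiff.1 hy).2 (Fin.ext e ▸ hx)

/-- Letters outside `b` do not change, and at the least element of `b 0` the letter is the minimum
of the label, before and after the splitting. -/
theorem split_letter_ne (hb : b ∈ X.blocks) (hI : IsSplit b I) {i : Fin s} {k : Fin n}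
    (h : (X.split b I).atomWord.letter i k ≠ X.atomWord.letter i k) :
    (b 0).minNat < k ∨ (b 0).minNat = k ∧ (I i.succ).minNat ≠ (b i.succ).minNat := by
  have hk : k ∈ b 0 := by
    by_contra hk
    obtain ⟨c, ⟨hc, hkc⟩, -⟩ := X.partition 0 k
    refine h (atomWord_letter_eq ((mem_blocks_split hb hI).2 (Or.inr (Or.inr ⟨?_, hc⟩))) hc i hkc)
    rintro rfl
    exact hk hkc
  refine (Finset.minNat_le hk).lt_or_eq.imp_right fun e => ⟨e, fun heq => h (Fin.ext ?_)⟩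
  have hkI : k ∈ I 0 := by
    obtain ⟨x, hx, hxb⟩ := hI.exists_min
    exact Fin.ext (hxb.trans e) ▸ hx
  rw [X.atomWord_letter_minNat hb i hk e.symm, ← heq,
    (X.split b I).atomWord_letter_minNat ((mem_blocks_split hb hI).2 (Or.inl rfl)) i hkI
      (e.symm.trans hI.minNat_eq.symm)]

theorem edgeLabel_split_of_minNat_ne (hb : b ∈ X.blocks) (hI : IsSplit b I) {i : Fin s}
    (hi : (I i.succ).minNat ≠ (b i.succ).minNat)
    (hlt : ∀ j < i, (I j.succ).minNat = (b j.succ).minNat) :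
    (X.split b I).atomWord ≠ X.atomWord ∧
      edgeLabel (X.split b I : VectorPartitionPoset n s) X = minLabel b i := by
  obtain ⟨x, hx, hxb⟩ := hI.exists_min
  have hletter := X.atomWord_letter_minNat hb i (hI.subset 0 hx) hxb
  have hne : (X.split b I).atomWord.letter i x ≠ X.atomWord.letter i x := by
    intro e
    rw [← e, (X.split b I).atomWord_letter_minNat ((mem_blocks_split hb hI).2 (Or.inl rfl)) i hx
      (hxb.trans hI.minNat_eq.symm)] at hletter
    exact hi hletter
  have hword : (X.split b I).atomWord ≠ X.atomWord := fun e => hne (by rw [e])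
  refine ⟨hword, ?_⟩
  have hlabel : minLabel b i =
      EdgeLabel.mk ((x : ℤ) + 1) ((i : ℤ) + 1) ((X.atomWord.letter i x : ℤ) + 1) := by
    rw [minLabel, ← hxb, hletter]
  rw [edgeLabel_of_ne hword]
  refine le_antisymm (Finset.min'_le _ _ (mem_differences.2 ⟨x, i, hne, hlabel⟩))
    (Finset.le_min' _ _ _ fun l hl => ?_)
  obtain ⟨k, j, hkj, rfl⟩ := mem_differences.1 hl
  rw [hlabel, EdgeLabel.mk_le_mk]
  rcases split_letter_ne hb hI hkj with h | ⟨h, hj⟩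
  · omega
  · obtain rfl : x = k := Fin.ext (hxb.trans h)
    rcases lt_trichotomy i j with hij | rfl | hij
    · have := Fin.lt_def.1 hij
      omega
    · omega
    · exact absurd (hlt j hij) hj

/-- No letter changes at the least element of the part, so every change has a first coordinate
larger than that of `minLabel I i`. -/
theorem minLabel_lt_edgeLabel_split (hb : b ∈ X.blocks) (hI : IsSplit b I)
    (hmin : ∀ i : Fin s, (I i.succ).minNat = (b i.succ).minNat)
    (hword : (X.split b I).atomWord ≠ X.atomWord) (i : Fin s) :
    minLabel I i < edgeLabel (X.split b I : VectorPartitionPoset n s) X := by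
  rw [edgeLabel_of_ne hword, Finset.lt_min'_iff]
  intro l hl
  obtain ⟨k, j, hkj, rfl⟩ := mem_differences.1 hl
  rcases split_letter_ne hb hI hkj with h | ⟨h, hj⟩
  · rw [minLabel, EdgeLabel.mk_lt_mk, hI.minNat_eq]
    omega
  · exact absurd (hmin j) hj

/-- If `I` consists of the minima alone, the first atom of `X` already matches them with each other,
so it lies below the splitting as well. -/
theorem atomWord_split_of_card_eq_one (hb : b ∈ X.blocks) (hI : IsSplit b I)
    (hmin : ∀ i : Fin s, (I i.succ).minNat = (b i.succ).minNat) (hcard : (I 0).card = 1) :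
    (X.split b I).atomWord = X.atomWord := by
  refine le_antisymm ?_ (atomWord_le_of_le (split_lt hb hI).le)
  refine (X.split b I).atomWordsBelow.min'_le _
    (mem_atomWordsBelow.2 ⟨X.atomWord_injective, fun c hc k hk i => ?_⟩)
  obtain ⟨x, hx, hxb⟩ := hI.exists_min
  obtain ⟨x', hx'⟩ := Finset.card_eq_one.1 hcard
  obtain ⟨y, hy⟩ := Finset.card_eq_one.1 ((hI.card_eq i.succ).trans hcard)
  obtain rfl : x = x' := by simpa [hx'] using hx
  have hletter : X.atomWord.letter i x = y := by
    refine Fin.ext ?_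
    obtain ⟨z, hz, hzm⟩ := Finset.exists_eq_minNat (hI.nonempty i.succ)
    obtain rfl : z = y := by simpa [hy] using hz
    rw [X.atomWord_letter_minNat hb i (hI.subset 0 hx) hxb, ← hmin i, hzm]
  rcases (mem_blocks_split hb hI).1 hc with rfl | rfl | hc
  · obtain rfl : k = x := by simpa [hx'] using hk
    simp [hy, hletter]
  · obtain ⟨hkb, hkI⟩ := Finset.mem_sdiff.1 hk
    refine Finset.mem_sdiff.2 ⟨X.atomWord_mem hb hkb i, fun h => hkI ?_⟩
    rw [hy, Finset.mem_singleton, ← hletter] at h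
    exact X.atomWord_injective i h ▸ hx
  · exact X.atomWord_mem hc.2 hk i

end

end VectorPartition

/-! ### The recursion and the number of splittings of a block -/

/-- The number of decreasing maximal chains of `Π_{n,s+1}` whose highest label has middle coordinate
`i`, for `n ≥ 2` and `1 ≤ i ≤ s`, given by its recursion. -/
def topCount (s : ℕ) : ℕ → ℕ → ℕ
  | n, i => ∑ α ∈ (Finset.Icc 1 (n - 1)).attach,
      ((if α.1 = 1 then 1 else 0) + ∑ i' ∈ Finset.Icc i s, topCount s α.1 i') *
      ((if n - α.1 = 1 then 1 else 0) + ∑ i' ∈ Finset.Icc 1 s, topCount s (n - α.1) i') *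
      ((n - 1).choose (α.1 - 1) ^ i * (n - 1).choose α.1 * n.choose α.1 ^ (s - i))
termination_by n => n
decreasing_by
  all_goals
    have := Finset.mem_Icc.1 α.2
    omega

/-- The number of decreasing maximal chains of `Π_{n,s+1}` whose highest label, if `n ≥ 2`, has
middle coordinate at least `i`. -/
def tailCount (s n i : ℕ) : ℕ := (if n = 1 then 1 else 0) + ∑ i' ∈ Finset.Icc i s, topCount s n i'

theorem topCount_eq (s n i : ℕ) :
    topCount s n i = ∑ α ∈ Finset.Icc 1 (n - 1), tailCount s α i * tailCount s (n - α) 1 *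
      ((n - 1).choose (α - 1) ^ i * (n - 1).choose α * n.choose α ^ (s - i)) := by
  rw [topCount, ← Finset.sum_attach (Finset.Icc 1 (n - 1))]
  rfl

theorem topCount_one (s i : ℕ) : topCount s 1 i = 0 := by
  rw [topCount_eq]
  simp

theorem sum_filter_fin_le {s : ℕ} (i : ℕ) (f : ℕ → ℕ) :
    ∑ j ∈ Finset.univ.filter (fun j : Fin s => i ≤ (j : ℕ)), f ((j : ℕ) + 1) =
      ∑ j ∈ Finset.Icc (i + 1) s, f j := by
  refine Finset.sum_bij (fun j _ => (j : ℕ) + 1) ?_ ?_ ?_ fun _ _ => rfl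
  · intro j hj
    have := (Finset.mem_filter.1 hj).2
    exact Finset.mem_Icc.2 ⟨by omega, j.2⟩
  · intro j _ j' _ h
    exact Fin.ext (by simpa using h)
  · intro j hj
    have := Finset.mem_Icc.1 hj
    refine ⟨⟨j - 1, by omega⟩, Finset.mem_filter.2 ⟨Finset.mem_univ _, ?_⟩, ?_⟩
    · show i ≤ j - 1
      omega
    · show j - 1 + 1 = j
      omega

theorem Finset.card_powersetCard_filter_mem {α : Type*} [DecidableEq α] {t : Finset α} {x : α}
    (hx : x ∈ t) {k : ℕ} (hk : 1 ≤ k) :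
    ((t.powersetCard k).filter fun u => x ∈ u).card = (t.card - 1).choose (k - 1) := by
  rw [← Finset.card_erase_of_mem hx, ← Finset.card_powersetCard]
  refine Finset.card_nbij' (fun u => u.erase x) (fun u => insert x u) ?_ ?_ ?_ ?_
  · intro u hu
    simp only [Finset.coe_filter, Finset.mem_powersetCard, Set.mem_ofPred_eq] at hu
    simp only [Finset.mem_coe, Finset.mem_powersetCard]
    exact ⟨Finset.erase_subset_erase x hu.1.1, by rw [Finset.card_erase_of_mem hu.2, hu.1.2]⟩
  · intro u hu
    simp only [Finset.mem_coe, Finset.mem_powersetCard] at hu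
    have hxu : x ∉ u := fun h => Finset.notMem_erase x t (hu.1 h)
    simp only [Finset.coe_filter, Finset.mem_powersetCard, Set.mem_ofPred_eq]
    refine ⟨⟨Finset.insert_subset hx (hu.1.trans (Finset.erase_subset _ _)), ?_⟩,
      Finset.mem_insert_self _ _⟩
    rw [Finset.card_insert_of_notMem hxu, hu.2]
    omega
  · intro u hu
    simp only [Finset.coe_filter, Finset.mem_powersetCard, Set.mem_ofPred_eq] at hu
    exact Finset.insert_erase hu.2
  · intro u hu
    simp only [Finset.mem_coe, Finset.mem_powersetCard] at hu
    exact Finset.erase_insert fun h => Finset.notMem_erase x t (hu.1 h)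

theorem Finset.card_powersetCard_filter_notMem {α : Type*} [DecidableEq α] {t : Finset α} {x : α}
    (hx : x ∈ t) (k : ℕ) :
    ((t.powersetCard k).filter fun u => x ∉ u).card = (t.card - 1).choose k := by
  rw [← Finset.card_erase_of_mem hx, ← Finset.card_powersetCard]
  congr 1
  ext u
  simp only [Finset.mem_filter, Finset.mem_powersetCard, Finset.subset_erase]
  tauto

theorem prod_fin_ite_eq (s : ℕ) {i : ℕ} (hi : i < s) (a b c : ℕ) :
    ∏ h : Fin (s + 1), (if (h : ℕ) ≤ i then a else if (h : ℕ) = i + 1 then b else c) =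
      a ^ (i + 1) * b * c ^ (s - (i + 1)) := by
  rw [Fin.prod_univ_eq_prod_range (fun h => if h ≤ i then a else if h = i + 1 then b else c),
    show s + 1 = i + 1 + 1 + (s - (i + 1)) by omega, Finset.prod_range_add,
    Finset.prod_range_succ]
  congr 1
  · congr 1
    · rw [Finset.prod_congr rfl (g := fun _ => a), Finset.prod_const, Finset.card_range]
      intro x hx
      rw [if_pos (Nat.lt_succ_iff.1 (Finset.mem_range.1 hx))]
    · simp
  · rw [Finset.prod_congr rfl (g := fun _ => c), Finset.prod_const, Finset.card_range]
    intro x _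
    rw [if_neg (by omega), if_neg (by omega)]

theorem Finset.minNat_eq_iff {n : ℕ} {t u : Finset (Fin n)} (hut : u ⊆ t) (hu : u.Nonempty)
    {x : Fin n} (hxt : (x : ℕ) = t.minNat) : u.minNat = t.minNat ↔ x ∈ u := by
  refine ⟨fun h => ?_, fun h => Finset.minNat_eq_of_mem hut h hxt⟩
  obtain ⟨y, hy, hyu⟩ := Finset.exists_eq_minNat hu
  exact Fin.ext (hxt.trans (h.symm.trans hyu.symm)) ▸ hy

namespace VectorPartition

variable {n s : ℕ}

/-- `i` is the first index for which the `i`th label of `I` does not contain the least element of the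
`i`th label of `b`. -/
def IsFirstMissing (b I : Fin (s + 1) → Finset (Fin n)) (i : Fin s) : Prop :=
  (I i.succ).minNat ≠ (b i.succ).minNat ∧ ∀ j < i, (I j.succ).minNat = (b j.succ).minNat

theorem IsFirstMissing.unique {b I : Fin (s + 1) → Finset (Fin n)} {i j : Fin s}
    (hi : IsFirstMissing b I i) (hj : IsFirstMissing b I j) : i = j := by
  rcases lt_trichotomy i j with h | h | h
  · exact absurd (hj.2 i h) hi.1
  · exact h
  · exact absurd (hi.2 j h) hj.1

theorem exists_isFirstMissing {b I : Fin (s + 1) → Finset (Fin n)} {i : Fin s}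
    (hi : (I i.succ).minNat ≠ (b i.succ).minNat) : ∃ j, IsFirstMissing b I j := by
  induction i using WellFoundedLT.induction with
  | ind i ih =>
    by_cases h : ∀ j < i, (I j.succ).minNat = (b j.succ).minNat
    · exact ⟨i, hi, h⟩
    · push Not at h
      obtain ⟨j, hj, hne⟩ := h
      exact ih j hj hne

open Classical in
theorem card_isFirstMissing (X : VectorPartition n s) {b : Fin (s + 1) → Finset (Fin n)}
    (hb : b ∈ X.blocks) (i : Fin s) {α : ℕ} (hα : α ∈ Finset.Icc 1 ((b 0).card - 1)) :
    (Finset.univ.filter fun I => (IsSplit b I ∧ IsFirstMissing b I i) ∧ (I 0).card = α).card =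
      ((b 0).card - 1).choose (α - 1) ^ ((i : ℕ) + 1) * ((b 0).card - 1).choose α *
        (b 0).card.choose α ^ (s - ((i : ℕ) + 1)) := by
  obtain ⟨hα1, hαm⟩ := Finset.mem_Icc.1 hα
  have hcard : ∀ h, (b h).card = (b 0).card := X.card_eq b hb
  have hbpos : 0 < (b 0).card := Finset.card_pos.2 (X.nonempty b hb)
  have hne : ∀ h, (b h).Nonempty := fun h => Finset.card_pos.1 (by rw [hcard h]; exact hbpos)
  choose p hp hpmin using fun h => Finset.exists_eq_minNat (hne h)
  -- The conditions on the coordinates of `I` are independent once the size is fixed. Coordinate `0`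
  -- is the part, so `h ≤ i` covers the part and the labels before the first missing one, which is
  -- coordinate `i + 1`.
  let T : Fin (s + 1) → Finset (Finset (Fin n)) := fun h =>
    if (h : ℕ) ≤ i then ((b h).powersetCard α).filter fun u => p h ∈ u
    else if (h : ℕ) = i + 1 then ((b h).powersetCard α).filter fun u => p h ∉ u
    else (b h).powersetCard α
  have hT : (Finset.univ.filter fun I => (IsSplit b I ∧ IsFirstMissing b I i) ∧ (I 0).card = α) =
      Fintype.piFinset T := by
    ext I
    simp only [Finset.mem_filter, Finset.mem_univ, true_and, Fintype.mem_piFinset]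
    constructor
    · rintro ⟨⟨hI, hfirst⟩, hIα⟩ h
      have hmem : I h ∈ (b h).powersetCard α :=
        Finset.mem_powersetCard.2 ⟨hI.subset h, (hI.card_eq h).trans hIα⟩
      have hiff := Finset.minNat_eq_iff (hI.subset h) (hI.nonempty h) (hpmin h)
      simp only [T]
      split_ifs with h1 h2
      · refine Finset.mem_filter.2 ⟨hmem, hiff.1 ?_⟩
        induction h using Fin.cases with
        | zero => exact hI.minNat_eq
        | succ j => exact hfirst.2 j (Fin.lt_def.2 (by rw [Fin.val_succ] at h1; omega))
      · obtain rfl : h = i.succ := Fin.ext (by rw [Fin.val_succ]; exact h2)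
        exact Finset.mem_filter.2 ⟨hmem, fun hm => hfirst.1 (hiff.2 hm)⟩
      · exact hmem
    · intro hI
      have hmem : ∀ h, I h ∈ (b h).powersetCard α := by
        intro h
        have := hI h
        simp only [T] at this
        split_ifs at this
        · exact (Finset.mem_filter.1 this).1
        · exact (Finset.mem_filter.1 this).1
        · exact this
      have hsub : ∀ h, I h ⊆ b h := fun h => (Finset.mem_powersetCard.1 (hmem h)).1
      have hIα : ∀ h, (I h).card = α := fun h => (Finset.mem_powersetCard.1 (hmem h)).2
      have hIne : ∀ h, (I h).Nonempty := fun h => Finset.card_pos.1 (by rw [hIα h]; exact hα1)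
      have hiff := fun h => Finset.minNat_eq_iff (hsub h) (hIne h) (hpmin h)
      have hlow : ∀ h : Fin (s + 1), (h : ℕ) ≤ i → p h ∈ I h := by
        intro h hle
        have := hI h
        simp only [T, if_pos hle] at this
        exact (Finset.mem_filter.1 this).2
      refine ⟨⟨⟨hsub, fun h => (hIα h).trans (hIα 0).symm, ⟨p 0, hlow 0 (Nat.zero_le _), hpmin 0⟩,
        fun h => ?_⟩, fun h => ?_, fun j hj => ?_⟩, hIα 0⟩
      · have := hIα 0
        rw [h] at this
        omega
      · have hi := hI i.succ
        simp only [T, Fin.val_succ, if_neg (Nat.not_succ_le_self (i : ℕ)), if_true] at hi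
        exact (Finset.mem_filter.1 hi).2 ((hiff i.succ).1 h)
      · exact (hiff j.succ).2 (hlow j.succ (by rw [Fin.val_succ]; exact Fin.lt_def.1 hj))
  rw [hT, Fintype.card_piFinset, ← prod_fin_ite_eq s i.2]
  refine Finset.prod_congr rfl fun h _ => ?_
  simp only [T]
  split_ifs
  · rw [Finset.card_powersetCard_filter_mem (hp h) hα1, hcard]
  · rw [Finset.card_powersetCard_filter_notMem (hp h), hcard]
  · rw [Finset.card_powersetCard, hcard]

/-- The number of decreasing maximal chains of the interval below the block `b` whose labels are at
least `L`. -/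
def weight (b : Fin (s + 1) → Finset (Fin n)) (L : EdgeLabel) : ℕ :=
  (if (b 0).card = 1 then 1 else 0) +
    ∑ i : Fin s with L ≤ minLabel b i, topCount s (b 0).card ((i : ℕ) + 1)

theorem weight_eq_tailCount {b : Fin (s + 1) → Finset (Fin n)} {L : EdgeLabel} (i : ℕ)
    (h : ∀ j : Fin s, L ≤ minLabel b j ↔ i ≤ j) :
    weight b L = tailCount s (b 0).card (i + 1) := by
  rw [weight, tailCount, ← sum_filter_fin_le]
  simp only [h]

/-- The parts of `I` and `b` have the same least element, so the index decides the comparison; at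
equal index, the minimum of a subset is at least that of the set. -/
theorem weight_of_isSplit {b I : Fin (s + 1) → Finset (Fin n)} (hI : IsSplit b I)
    (i : Fin s) : weight I (minLabel b i) = tailCount s (I 0).card ((i : ℕ) + 1) := by
  refine weight_eq_tailCount _ fun j => ?_
  rw [minLabel, minLabel, EdgeLabel.mk_le_mk, hI.minNat_eq]
  constructor
  · omega
  · intro hij
    rcases hij.lt_or_eq with hlt | heq
    · omega
    · obtain rfl := Fin.ext heq
      have := Finset.minNat_mono (hI.subset i.succ) (hI.nonempty i.succ)
      omega

/-- The part of `b \ I` has a larger least element than `b 0`, so the bound excludes no index. -/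
theorem weight_sdiff_of_isSplit (X : VectorPartition n s) {b I : Fin (s + 1) → Finset (Fin n)}
    (hb : b ∈ X.blocks) (hI : IsSplit b I) (i : Fin s) :
    weight (b \ I) (minLabel b i) = tailCount s ((b 0).card - (I 0).card) 1 := by
  rw [← X.card_sdiff_of_isSplit hb hI 0]
  refine weight_eq_tailCount 0 fun j => ?_
  have := hI.minNat_sdiff_gt (X.sdiff_nonempty_of_isSplit hb hI 0)
  rw [minLabel, minLabel, EdgeLabel.mk_le_mk]
  omega

open Classical in
theorem sum_weight_mul_weight (X : VectorPartition n s) {b : Fin (s + 1) → Finset (Fin n)}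
    (hb : b ∈ X.blocks) (i : Fin s) :
    ∑ I with IsSplit b I ∧ IsFirstMissing b I i,
      weight I (minLabel b i) * weight (b \ I) (minLabel b i) =
      topCount s (b 0).card ((i : ℕ) + 1) := by
  rw [← Finset.sum_fiberwise_of_maps_to (t := Finset.Icc 1 ((b 0).card - 1))
    (g := fun I => (I 0).card), topCount_eq]
  · refine Finset.sum_congr rfl fun α hα => ?_
    rw [← X.card_isFirstMissing hb i hα, Finset.filter_filter, mul_comm _ (Finset.card _),
      ← smul_eq_mul (Finset.card _), ← Finset.sum_const]
    refine Finset.sum_congr rfl fun I hI => ?_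
    obtain ⟨⟨hsplit, -⟩, hcard⟩ := (Finset.mem_filter.1 hI).2
    rw [weight_of_isSplit hsplit, X.weight_sdiff_of_isSplit hb hsplit, hcard]
  · intro I hI
    obtain ⟨hI, -⟩ := (Finset.mem_filter.1 hI).2
    have := hI.card_lt
    have := hI.card_pos 0
    exact Finset.mem_Icc.2 ⟨by omega, by omega⟩

theorem bot_covBy_coe_iff (X : VectorPartition n s) :
    (⊥ : VectorPartitionPoset n s) ⋖ X ↔ ∀ b ∈ X.blocks, (b 0).card = 1 := by
  rw [WithBot.bot_covBy_coe]
  constructor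
  · intro hX b hb
    have hpos : 0 < (b 0).card := Finset.card_pos.2 (X.nonempty b hb)
    by_contra hcard
    have hne : ∀ h, (b h).Nonempty := fun h =>
      Finset.card_pos.1 (by rw [X.card_eq b hb h]; exact hpos)
    choose p hp hpmin using fun h => Finset.exists_eq_minNat (hne h)
    -- A block that is not a singleton can be split by taking the minimum of each coordinate.
    have hI : IsSplit b fun h => {p h} :=
      ⟨fun h => Finset.singleton_subset_iff.2 (hp h), fun h => by simp,
        ⟨p 0, Finset.mem_singleton_self _, hpmin 0⟩, fun h => hcard (by rw [← h]; simp)⟩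
    exact hX.not_lt (split_lt hb hI)
  · intro hX
    refine isMin_iff_forall_not_lt.2 fun Y hY => ?_
    obtain ⟨b, hb, I, hI, -⟩ := exists_le_split_of_lt hY
    have h1 := hI.card_lt
    have h2 := hI.card_pos 0
    rw [hX b hb] at h1
    omega

end VectorPartition

/-! ### The product formula for decreasing chains -/

namespace VectorPartition

variable {n s : ℕ}

/-- The number of decreasing maximal chains below `X` whose labels are at least `L`. -/
noncomputable def chainCount (X : VectorPartition n s) (L : EdgeLabel) : ℕ :=
  (decreasingChainsBelow edgeLabel (X : VectorPartitionPoset n s) fun y =>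
    L ≤ edgeLabel y X).ncard

open Classical in
theorem ncard_decreasingChainsBelow_coe (X : VectorPartition n s) (q : EdgeLabel → Prop)
    [DecidablePred q] :
    (decreasingChainsBelow edgeLabel (X : VectorPartitionPoset n s) fun y =>
      q (edgeLabel y X)).ncard =
      (if (⊥ : VectorPartitionPoset n s) ⋖ X ∧ q (edgeLabel (⊥ : VectorPartitionPoset n s) X)
        then 1 else 0) +
      ∑ b ∈ X.blocks, ∑ I with IsSplit b I,
        if q (edgeLabel (X.split b I : VectorPartitionPoset n s) X) then
          chainCount (X.split b I) (edgeLabel (X.split b I : VectorPartitionPoset n s) X)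
        else 0 := by
  let _ : Fintype (VectorPartitionPoset n s) := instFintypeOption
  rw [ncard_decreasingChainsBelow edgeLabel WithBot.coe_ne_bot, Finset.sum_filter]
  refine (Fintype.sum_option _).trans ?_
  congr 1
  · refine if_congr Iff.rfl ?_ rfl
    exact ncard_decreasingChainsBelow_bot _ _
  · rw [← sum_covBy X fun Y => if q (edgeLabel (Y : VectorPartitionPoset n s) X) then
      chainCount Y (edgeLabel (Y : VectorPartitionPoset n s) X) else 0, Finset.sum_filter]
    refine Finset.sum_congr rfl fun Y _ => ?_
    rw [← ite_and]
    exact if_congr (and_congr_left' WithBot.coe_covBy_coe) rfl rfl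

/-- A chain counted here would have all labels at least `(n, m, 0)`, but its bottom edge has first
coordinate `n - 1`. -/
theorem chainCount_eq_zero (X : VectorPartition n s) {m : ℕ} :
    chainCount X (EdgeLabel.mk n m 0) = 0 := by
  classical
  induction X using WellFoundedLT.induction generalizing m with
  | ind X ih =>
    rw [chainCount, ncard_decreasingChainsBelow_coe X fun l => EdgeLabel.mk n m 0 ≤ l, if_neg,
      zero_add]
    · refine Finset.sum_eq_zero fun b hb => Finset.sum_eq_zero fun I hI => ?_
      replace hI := (Finset.mem_filter.1 hI).2
      by_cases hw : (X.split b I).atomWord = X.atomWord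
      · rw [edgeLabel_of_eq hw, ih _ (split_lt hb hI), ite_self]
      · rw [if_neg]
        intro hle
        have := hle.trans_lt (edgeLabel_lt_of_ne hw)
        rw [EdgeLabel.mk_lt_mk] at this
        omega
    · rintro ⟨-, hle⟩
      rw [edgeLabel_bot, EdgeLabel.mk_le_mk] at hle
      omega

open Classical in
-- Only splittings with a first missing index `i` contribute. For these the two new blocks
-- contribute a product of weights that sums to `topCount`, and the other blocks keep their weights
-- at the bound `minLabel b i`.
theorem sum_isSplit_chainCount (X : VectorPartition n s) (q : EdgeLabel → Prop)
    [DecidablePred q]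
    (ih : ∀ Y < X, ∀ L ≤ EdgeLabel.mk ((n : ℤ) - 1) ((s : ℤ) + 1) 0,
      chainCount Y L = ∏ b ∈ Y.blocks, weight b L)
    {b : Fin (s + 1) → Finset (Fin n)} (hb : b ∈ X.blocks) :
    (∑ I with IsSplit b I,
      if q (edgeLabel (X.split b I : VectorPartitionPoset n s) X) then
        chainCount (X.split b I) (edgeLabel (X.split b I : VectorPartitionPoset n s) X)
      else 0) =
    ∑ i : Fin s with q (minLabel b i), topCount s (b 0).card ((i : ℕ) + 1) *
      ∏ c ∈ X.blocks.erase b, weight c (minLabel b i) := by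
  have hterm : ∀ I, IsSplit b I →
      (if q (edgeLabel (X.split b I : VectorPartitionPoset n s) X) then
        chainCount (X.split b I) (edgeLabel (X.split b I : VectorPartitionPoset n s) X)
      else 0) = ∑ i : Fin s, if IsFirstMissing b I i ∧ q (minLabel b i) then
        weight I (minLabel b i) * weight (b \ I) (minLabel b i) *
          ∏ c ∈ X.blocks.erase b, weight c (minLabel b i) else 0 := by
    intro I hI
    by_cases hex : ∃ i, IsFirstMissing b I i
    · obtain ⟨i, hi⟩ := hex
      obtain ⟨hword, hlabel⟩ := edgeLabel_split_of_minNat_ne hb hI hi.1 hi.2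
      have hle := (edgeLabel_lt_of_ne hword).le
      rw [Finset.sum_eq_single i]
      · rw [hlabel] at hle ⊢
        rw [ih _ (split_lt hb hI) _ hle, prod_blocks_split _ hb hI]
        exact if_congr (and_iff_right hi).symm rfl rfl
      · intro j _ hj
        exact if_neg fun h => hj (h.1.unique hi)
      · exact fun h => absurd (Finset.mem_univ i) h
    · have hmin : ∀ i : Fin s, (I i.succ).minNat = (b i.succ).minNat := fun i => by
        by_contra hi
        exact hex (exists_isFirstMissing hi)
      rw [Finset.sum_eq_zero fun i _ => if_neg fun h => hex ⟨i, h.1⟩]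
      refine ite_eq_right_iff.2 fun _ => ?_
      -- Without a missing minimum the contribution is zero: an unchanged first atom gives a label
      -- that is too large, a changed one makes the weight of `I` vanish.
      by_cases hword : (X.split b I).atomWord = X.atomWord
      · rw [edgeLabel_of_eq hword, chainCount_eq_zero]
      · rw [ih _ (split_lt hb hI) _ (edgeLabel_lt_of_ne hword).le]
        refine Finset.prod_eq_zero ((mem_blocks_split hb hI).2 (Or.inl rfl)) ?_
        rw [weight, if_neg fun h => hword (atomWord_split_of_card_eq_one hb hI hmin h), zero_add]
        refine Finset.sum_eq_zero fun i hi => ?_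
        exact absurd (Finset.mem_filter.1 hi).2
          (minLabel_lt_edgeLabel_split hb hI hmin hword i).not_ge
  rw [Finset.sum_congr rfl fun I hI => hterm I (Finset.mem_filter.1 hI).2, Finset.sum_comm,
    Finset.sum_filter]
  refine Finset.sum_congr rfl fun i _ => ?_
  by_cases hq : q (minLabel b i)
  · simp only [hq, and_true, if_true]
    rw [← Finset.sum_filter, Finset.filter_filter, ← Finset.sum_mul, X.sum_weight_mul_weight hb i]
  · simp [hq]

theorem minLabel_injOn (X : VectorPartition n s) :
    Set.InjOn (fun p : (Fin (s + 1) → Finset (Fin n)) × Fin s => minLabel p.1 p.2)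
      {p | p.1 ∈ X.blocks} := by
  rintro ⟨b, i⟩ hb ⟨c, j⟩ hc h
  obtain ⟨x, hx, hxb⟩ := Finset.exists_eq_minNat (X.nonempty b hb)
  obtain ⟨y, hy, hyc⟩ := Finset.exists_eq_minNat (X.nonempty c hc)
  have h1 := EdgeLabel.mk_le_mk.1 (le_of_eq h)
  have h2 := EdgeLabel.mk_le_mk.1 (ge_of_eq h)
  simp only at h1 h2
  obtain rfl : x = y := Fin.ext (by omega)
  obtain rfl := X.blocks_eq hb hc hx hy
  obtain rfl : i = j := Fin.ext (by omega)
  rfl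

theorem chainCount_eq_prod (X : VectorPartition n s) {L : EdgeLabel}
    (hL : L ≤ EdgeLabel.mk ((n : ℤ) - 1) ((s : ℤ) + 1) 0) :
    chainCount X L = ∏ b ∈ X.blocks, weight b L := by
  classical
  induction X using WellFoundedLT.induction generalizing L with
  | ind X ih =>
    -- Here `hL` is used: every bottom edge satisfies the bound `L`, so the `⊥` term only tests
    -- whether all blocks are singletons.
    have hfirst : (if (⊥ : VectorPartitionPoset n s) ⋖ X ∧
        L ≤ edgeLabel (⊥ : VectorPartitionPoset n s) X then 1 else 0) =
        ∏ b ∈ X.blocks, if (b 0).card = 1 then 1 else 0 := by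
      by_cases hX : (⊥ : VectorPartitionPoset n s) ⋖ X
      · rw [if_pos ⟨hX, hL.trans (edgeLabel_bot_ge hX)⟩, Finset.prod_eq_one]
        exact fun b hb => if_pos ((bot_covBy_coe_iff X).1 hX b hb)
      · rw [if_neg fun h => hX h.1]
        rw [bot_covBy_coe_iff] at hX
        push Not at hX
        obtain ⟨b, hb, hcard⟩ := hX
        exact (Finset.prod_eq_zero hb (if_neg hcard)).symm
    rw [chainCount, ncard_decreasingChainsBelow_coe X fun l => L ≤ l, hfirst,
      Finset.sum_congr rfl fun b hb =>
        X.sum_isSplit_chainCount (fun l => L ≤ l) (fun Y hY L hL => ih Y hY hL) hb]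
    set S := (X.blocks ×ˢ (Finset.univ : Finset (Fin s))).filter
      fun p => L ≤ minLabel p.1 p.2 with hS
    -- Stated for a general `q` to serve both sides of the identity: the trivial condition for the
    -- full weights, a lower bound on the label for the restricted ones.
    have hsum : ∀ b ∈ X.blocks, ∀ q : (Fin (s + 1) → Finset (Fin n)) × Fin s → Prop,
        ∀ [DecidablePred q], ∑ p ∈ S with p.1 = b ∧ q p, topCount s (p.1 0).card ((p.2 : ℕ) + 1) =
          ∑ i : Fin s with L ≤ minLabel b i ∧ q (b, i), topCount s (b 0).card ((i : ℕ) + 1) := by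
      intro b hb q _
      rw [hS, Finset.filter_filter, Finset.sum_filter, Finset.sum_product,
        Finset.sum_eq_single b, Finset.sum_filter]
      · refine Finset.sum_congr rfl fun i _ => if_congr ?_ rfl rfl
        simp
      · intro c _ hcb
        exact Finset.sum_eq_zero fun i _ => if_neg fun h => hcb h.2.1
      · exact fun h => absurd hb h
    have key := prod_add_sum_filter_eq X.blocks (fun b => if (b 0).card = 1 then 1 else 0)
      (fun p : (Fin (s + 1) → Finset (Fin n)) × Fin s => topCount s (p.1 0).card ((p.2 : ℕ) + 1))
      (fun p : (Fin (s + 1) → Finset (Fin n)) × Fin s => minLabel p.1 p.2) S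
      (fun p hp => (Finset.mem_product.1 (Finset.mem_filter.1 hp).1).1)
      (X.minLabel_injOn.mono fun p hp => (Finset.mem_product.1 (Finset.mem_filter.1 hp).1).1)
    have hlhs : ∏ b ∈ X.blocks, weight b L = ∏ b ∈ X.blocks, ((if (b 0).card = 1 then 1 else 0) +
        ∑ p ∈ S with p.1 = b, topCount s (p.1 0).card ((p.2 : ℕ) + 1)) := by
      refine Finset.prod_congr rfl fun b hb => ?_
      have := hsum b hb fun _ => True
      simp only [and_true] at this
      rw [this, weight]
    rw [hlhs, key]
    congr 1
    rw [hS, Finset.sum_filter, Finset.sum_product]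
    refine Finset.sum_congr rfl fun b hb => ?_
    rw [Finset.sum_filter]
    refine Finset.sum_congr rfl fun i _ => ?_
    by_cases hi : L ≤ minLabel b i
    · rw [if_pos hi, if_pos hi]
      congr 1
      refine Finset.prod_congr (by congr!) fun c hc => ?_
      dsimp only at hc ⊢
      rw [← hS, hsum c (Finset.mem_of_mem_erase hc) fun p => minLabel b i ≤ minLabel p.1 p.2, weight]
      congr 2
      exact Finset.filter_congr fun j _ => (and_iff_right_of_imp hi.trans).symm
    · rw [if_neg hi, if_neg hi]

/-- The partition of `[n]` with a single block. -/
def single (n s : ℕ) (hn : 1 ≤ n) : VectorPartition n s where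
  blocks := {fun _ => Finset.univ}
  nonempty := by
    intro b hb
    rw [Finset.mem_singleton.1 hb]
    exact ⟨⟨0, hn⟩, Finset.mem_univ _⟩
  card_eq := by
    intro b hb h
    rw [Finset.mem_singleton.1 hb]
  partition := fun h x => ⟨_, ⟨Finset.mem_singleton_self _, Finset.mem_univ x⟩,
    fun b hb => Finset.mem_singleton.1 hb.1⟩

theorem le_single (hn : 1 ≤ n) (z : VectorPartitionPoset n s) : z ≤ single n s hn := by
  induction z using WithBot.recBotCoe with
  | bot => exact bot_le
  | coe X =>
    exact WithBot.coe_le_coe.2 ((le_iff _ _).2 fun b _ =>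
      ⟨_, Finset.mem_singleton_self _, fun h => Finset.subset_univ _⟩)

open Classical in
theorem ncard_decreasingChainsBelow_single (hn : 1 ≤ n) (q : EdgeLabel → Prop)
    [DecidablePred q] :
    (decreasingChainsBelow edgeLabel (single n s hn : VectorPartitionPoset n s) fun y =>
      q (edgeLabel y (single n s hn))).ncard =
      (if n = 1 ∧ q (edgeLabel (⊥ : VectorPartitionPoset n s) (single n s hn)) then 1 else 0) +
      ∑ i : Fin s with q (minLabel (fun _ => (Finset.univ : Finset (Fin n))) i),
        topCount s n ((i : ℕ) + 1) := by
  have hb : (fun _ => Finset.univ) ∈ (single n s hn).blocks := Finset.mem_singleton_self _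
  have hblocks : (single n s hn).blocks = {fun _ => Finset.univ} := rfl
  rw [ncard_decreasingChainsBelow_coe]
  congr 1
  · refine if_congr (and_congr_left' ?_) rfl rfl
    rw [bot_covBy_coe_iff, hblocks]
    simp
  · rw [hblocks, Finset.sum_singleton, sum_isSplit_chainCount _ _
      (fun Y _ L hL => chainCount_eq_prod Y hL) hb]
    simp [hblocks]

end VectorPartition

/-! ### The counts for the whole poset -/

open VectorPartition in
theorem ncard_decreasingChains_eq_tailCount {n : ℕ} (hn : 1 ≤ n) (s : ℕ) :
    (decreasingChains n s).ncard = tailCount s n 1 := by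
  rw [ncard_decreasingChains (le_single hn), ncard_decreasingChainsBelow_single hn fun _ => True,
    tailCount, ← sum_filter_fin_le 0]
  simp

open VectorPartition in
theorem ncard_decreasingChainsWithTop_eq_topCount {n s i : ℕ} (hn : 2 ≤ n) (hi : 1 ≤ i)
    (his : i ≤ s) : (decreasingChainsWithTop n s i).ncard = topCount s n i := by
  classical
  have hn1 : 1 ≤ n := one_le_two.trans hn
  rw [ncard_decreasingChainsWithTop i (le_single hn1) WithBot.coe_ne_bot,
    ncard_decreasingChainsBelow_single hn1 fun l => l.middle = i, if_neg (by omega), zero_add,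
    -- The second coordinate of `minLabel` is the index plus one, so only index `i - 1` has middle
    -- coordinate `i`.
    Finset.sum_eq_single ⟨i - 1, by omega⟩]
  · congr 1
    show i - 1 + 1 = i
    omega
  · intro j hj hne
    refine absurd (Fin.ext ?_) hne
    have h : ((j : ℤ) + 1) = i := (Finset.mem_filter.1 hj).2
    show (j : ℕ) = i - 1
    omega
  · intro h
    refine absurd (Finset.mem_filter.2 ⟨Finset.mem_univ _, ?_⟩) h
    show (((i - 1 : ℕ) : ℤ) + 1) = i
    omega

theorem theorem4p5 :
    (∀ s : ℕ, (decreasingChains 1 s).ncard = 1) ∧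
    ∀ n s i : ℕ, 2 ≤ n → 1 ≤ s → 1 ≤ i → i ≤ s →
      (decreasingChainsWithTop n s i).ncard =
        ∑ α ∈ Finset.Icc 1 (n - 1),
          (if α = 1 then (decreasingChains α s).ncard
            else ∑ i' ∈ Finset.Icc i s, (decreasingChainsWithTop α s i').ncard) *
          (decreasingChains (n - α) s).ncard *
          (n - 1).choose (α - 1) ^ i * (n - 1).choose α * n.choose α ^ (s - i) := by
  have hone : ∀ s i, tailCount s 1 i = 1 := fun s i => by
    rw [tailCount, if_pos rfl, Finset.sum_eq_zero fun i' _ => topCount_one s i', add_zero]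
  refine ⟨fun s => by rw [ncard_decreasingChains_eq_tailCount le_rfl, hone], ?_⟩
  intro n s i hn _ hi his
  rw [ncard_decreasingChainsWithTop_eq_topCount hn hi his, topCount_eq]
  refine Finset.sum_congr rfl fun α hα => ?_
  obtain ⟨hα1, hαn⟩ := Finset.mem_Icc.1 hα
  have hfactor : tailCount s α i = if α = 1 then (decreasingChains α s).ncard
      else ∑ i' ∈ Finset.Icc i s, (decreasingChainsWithTop α s i').ncard := by
    split_ifs with h
    -- For `α = 1` there is no top index to restrict, and both sides equal `1`.
    · subst h
      rw [ncard_decreasingChains_eq_tailCount le_rfl, hone, hone]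
    · rw [tailCount, if_neg h, zero_add]
      refine Finset.sum_congr rfl fun i' hi' => ?_
      obtain ⟨h1, h2⟩ := Finset.mem_Icc.1 hi'
      exact (ncard_decreasingChainsWithTop_eq_topCount (by omega) (hi.trans h1) h2).symm
  rw [← hfactor, ncard_decreasingChains_eq_tailCount (by omega : 1 ≤ n - α)]
  ring
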